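/- \textbf{Setting.} Let $R$ be a $(q,s)$ chain ring: a finite commutative ring with $1\neq 0$ whose ideals are totally ordered by inclusion, with maximal ideal $\langle\pi\rangle$, residue field $R/\langle\pi\rangle$ of size $q$, and $s$ the least positive integer with $\pi^s=0$. Fix a complete set $Q\ni 0$ of residues modulo $\pi$. An $s$-shape is a sequence of integers $0\le\mu_1\le\dots\le\mu_s$; put $|\mu|=\sum_i\mu_i$, and identify an integer $t$ with the shape $(t,\dots,t)$. Let $R^\mu=\langle 1\rangle^{\mu_1}\times\langle\pi\rangle^{\mu_2-\mu_1}\times\dots\times\langle\pi^{s-1}\rangle^{\mu_s-\mu_{s-1}}$, a submodule of $R^m$ with $m=\mu_s$. Let $R^{n\times\mu}$ be the set of $n\times m$ matrices over $R$ whose rows lie in $R^\mu$. A matrix has shape $\kappa$ if its row span is isomorphic to $R^\kappa$, and $\mathcal T_\kappa(R^{n\times\mu})$ is the set of matrices of shape $\kappa$ in $R^{n\times\mu}$. The additive matrix channel (AMC) is $Y=X+Z$ with $X\in R^{n\times\mu}$ and $Z$ uniform over $\mathcal T_\tau(R^{n\times\mu})$, independent of $X$; its capacity in $q$-ary symbols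 is $C_{\mathrm{AMC}}=\max_{p_X}I(X;Y)$ (logarithms to base $q$). We take $\tau=t$, an integer. \textbf{Scheme.} Let $v$ be an integer with $t\le v\le n$ and $v\le\mu_1$. The data are arrays of symbols of $Q$, one of size $(n-v)\times(\mu_{i+1}-v)$ for each $i=0,\dots,s-1$. They are encoded as $U=\sum_{i=0}^{s-1}\pi^iU_i$, where $U_i$ is the $(n-v)\times(m-v)$ matrix whose first $\mu_{i+1}-v$ columns form the $i$-th array and whose other entries are $0$, and then as $X=\begin{pmatrix}0&0\\0&U\end{pmatrix}\in R^{n\times\mu}$ with $v$ zero rows and $v$ zero columns. The received matrix is split as $Y=\begin{pmatrix}Y_{11}&Y_{12}\\Y_{21}&Y_{22}\end{pmatrix}$ with $Y_{11}$ of size $v\times v$. If $Y_{11}$ does not have shape $t$, the decoder declares a failure; otherwise it chooses some $\bar T$ with $Y_{21}=\bar TY_{11}$ and outputs the data represented by $Y_{22}-\bar TY_{12}$. \textbf{Theorem.} (1) The encoder is injective and the codebook consists of all $\begin{pmatrix}0&0\\0&U\end{pmatrix}$ with $U\in R^{(n-v)\times(\mu-v)}$, so the rate ($\log_q$ of the size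 of the codebook) is $R_{\mathrm{AMC}}=\sum_{i=1}^s(n-v)(\mu_i-v)$. The set $\mathcal T_t(R^{n\times\mu})$ is nonempty. If $Z=BE$ with $B=\begin{pmatrix}B_1\\B_2\end{pmatrix}\in R^{n\times t}$ and $E=(E_1\ E_2)\in R^{t\times m}$, where $B_1$ consists of the first $v$ rows of $B$ and $E_1$ of the first $v$ columns of $E$, then the decoder fails if and only if $B_1E_1$ does not have shape $t$. For every transmitted message the probability of a wrong output is $0$, and the failure probability $P_f$ satisfies $$P_f<\frac{2t}{q^{1+v-t}}\quad\text{if } t\ge 1,\qquad P_f=0\quad\text{if } t=0.$$ (2) Fix $R$, and let $m=\mu_s\to\infty$ along a sequence of channels with $0\le t\le\min\{n,\mu_1\}$, where $\bar n=n/m>0$, $\bar\mu=\mu/m$ and $\bar\tau=t/m$ are fixed. Then $$\bar C_{\mathrm{AMC}}=\lim_{m\to\infty}\frac{C_{\mathrm{AMC}}}{n|\mu|}=\frac{\sum_{i=1}^s(\bar n-\bar\tau)(\bar\mu_i-\bar\tau)}{\bar n|\bar\mu|}.$$ For every choice of $v=v(m)$ with $t\le v\le\min\{n,\mu_1\}$,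 $v-t\to\infty$ and $(v-t)/m\to0$, the error probability is $0$, $P_f\to0$ uniformly over the messages, and $R_{\mathrm{AMC}}/(n|\mu|)\to\bar C_{\mathrm{AMC}}$. Such a choice exists whenever $\bar\tau<\min\{\bar n,\bar\mu_1\}$. -/

import Mathlib

open Filter Topology

noncomputable section

/-- `R` is a finite chain ring with maximal ideal `⟨π⟩`, residue field of size `q` and chain length
`s`, i.e. a `(q, s)` chain ring. -/
structure IsFiniteChainRing (R : Type*) [CommRing R] (π : R) (q s : ℕ) : Prop where
  nontrivial : Nontrivial R
  finite : Finite R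
  ideals_chain : ∀ I J : Ideal R, I ≤ J ∨ J ≤ I
  isMaximal : (Ideal.span {π}).IsMaximal
  card_residueField : Nat.card (R ⧸ Ideal.span {π}) = q
  nilpotency_index : IsLeast {l : ℕ | 0 < l ∧ π ^ l = 0} s

/-- A complete set of residues modulo `π` containing `0`. -/
structure IsResidueSystem {R : Type*} [CommRing R] (π : R) (Q : Set R) : Prop where
  zero_mem : (0 : R) ∈ Q
  existsUnique : ∀ a : R, ∃! r : R, r ∈ Q ∧ a - r ∈ Ideal.span {π}

/-! An `s`-shape `(μ₁ ≤ ⋯ ≤ μₛ)` is a monotone function `μ : Fin s → ℕ`, with `μ i` standing for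
`μ_{i+1}`; the integer `t` is identified with the shape `fun _ => t`. -/

/-- The last component `μₛ` of a shape (written as the largest component). -/
def packetLength {s : ℕ} (μ : Fin s → ℕ) : ℕ := Finset.univ.sup μ

theorem IsFiniteChainRing.le_packetLength {R : Type*} [CommRing R] {π : R} {q s : ℕ}
    (hR : IsFiniteChainRing R π q s) {μ : Fin s → ℕ} {v : ℕ} (hv : ∀ i, v ≤ μ i) :
    v ≤ packetLength μ :=
  (hv ⟨0, hR.nilpotency_index.1.1⟩).trans (Finset.le_sup (Finset.mem_univ _))

/-- The tuples of length `m` whose first `μ₁` components are arbitrary, whose next `μ₂ - μ₁`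
components are multiples of `π`, the next `μ₃ - μ₂` multiples of `π²`, and so on: the component
with (zero-based) index `j` lies in `⟨π ^ l⟩`, where `l` is the number of `i` with `μᵢ ≤ j`. -/
def rowModule {R : Type*} [CommRing R] (π : R) {s : ℕ} (μ : Fin s → ℕ) (m : ℕ) :
    Submodule R (Fin m → R) :=
  Submodule.pi Set.univ fun j : Fin m =>
    Ideal.span {π ^ (Finset.univ.filter fun i : Fin s => μ i ≤ (j : ℕ)).card}

/-- The `R`-module `R^μ`. -/
abbrev shapeModule {R : Type*} [CommRing R] (π : R) {s : ℕ} (μ : Fin s → ℕ) :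
    Submodule R (Fin (packetLength μ) → R) :=
  rowModule π μ (packetLength μ)

/-- `shape A = κ`: the row span of `A` is isomorphic to `R^κ`. -/
def HasShape {R : Type*} [CommRing R] (π : R) {s : ℕ} (κ : Fin s → ℕ) {ι c : Type*}
    (A : Matrix ι c R) : Prop :=
  Monotone κ ∧ Nonempty (Submodule.span R (Set.range fun i : ι => A i) ≃ₗ[R] shapeModule π κ)

/-- `R^{n × μ}`, with rows written as tuples of length `m` (where `m = μₛ`). -/
def matrixSpace {R : Type*} [CommRing R] (π : R) (n : ℕ) {s : ℕ} (μ : Fin s → ℕ) (m : ℕ) :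
    Set (Matrix (Fin n) (Fin m) R) :=
  {X | ∀ i, X i ∈ rowModule π μ m}

/-- `𝒯_κ(R^{n × μ})`, the matrices in `R^{n × μ}` of shape `κ`. -/
def shapedMatrices {R : Type*} [CommRing R] (π : R) {s : ℕ} (κ : Fin s → ℕ) (n : ℕ)
    (μ : Fin s → ℕ) : Set (Matrix (Fin n) (Fin (packetLength μ)) R) :=
  {Z | Z ∈ matrixSpace π n μ (packetLength μ) ∧ HasShape π κ Z}

/-- Probability of the event `E` under the uniform distribution on the finite nonempty set `S`. -/
def uniformProb {Ω : Type*} (S E : Set Ω) : ℝ := ((S ∩ E).ncard : ℝ) / (S.ncard : ℝ)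

/-! ### Capacity of a discrete memoryless channel -/

/-- The mutual information `I(X;Y)`, with logarithms to the base `b`, for the input distribution
`p` and the transition probabilities `W x y = p_{Y|X}(y | x)`. -/
def mutualInformation {α β : Type*} [Fintype α] [Fintype β] (b : ℝ) (p : α → ℝ)
    (W : α → β → ℝ) : ℝ :=
  ∑ x, ∑ y, p x * W x y * Real.logb b (W x y / ∑ x', p x' * W x' y)

/-- `max_{p_X} I(X;Y)`. -/
def channelCapacity {α β : Type*} [Fintype α] [Fintype β] (b : ℝ) (W : α → β → ℝ) : ℝ :=
  sSup ((fun p => mutualInformation b p W) '' stdSimplex ℝ α)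

/-- The transition probabilities of the additive matrix channel `Y = X + Z`, where `Z` is uniform
over `𝒯_τ(R^{n × μ})` and independent of `X`; both alphabets are `R^{n × μ}`. -/
def amcTransition {R : Type*} [CommRing R] (π : R) {s : ℕ} (τ : Fin s → ℕ) (n : ℕ)
    (μ : Fin s → ℕ) (X Y : matrixSpace π n μ (packetLength μ)) : ℝ :=
  uniformProb (shapedMatrices π τ n μ) {Z | X.1 + Z = Y.1}

/-- The capacity of the additive matrix channel, in `q`-ary symbols per channel use. -/
def amcCapacity {R : Type*} [CommRing R] [Finite R] (π : R) (q : ℕ) {s : ℕ} (τ : Fin s → ℕ)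
    (n : ℕ) (μ : Fin s → ℕ) : ℝ :=
  letI : Fintype (matrixSpace π n μ (packetLength μ)) := Fintype.ofFinite _
  channelCapacity (q : ℝ) (amcTransition π τ n μ)

/-! ### The error-trapping coding scheme -/

/-- The data: for each `i`, an `(n - v) × (μᵢ - v)` array of `q`-ary symbols (elements of the
residue system `Q`). -/
abbrev AmcMessage {R : Type*} (Q : Set R) {s : ℕ} (n : ℕ) (μ : Fin s → ℕ) (v : ℕ) : Type _ :=
  ∀ i : Fin s, Matrix (Fin (n - v)) (Fin (μ i - v)) Q

/-- The data matrix `U = U₀ + π U₁ + ⋯ + π^{s-1} U_{s-1}` of size `(n - v) × (m - v)`, `m = μₛ`,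
where the symbols of the `i`-th array fill the first `μ_{i+1} - v` columns of `Uᵢ`, and the other
entries of `Uᵢ` are zero. -/
def dataMatrix {R : Type*} [CommRing R] (π : R) (Q : Set R) {s : ℕ} (n : ℕ) (μ : Fin s → ℕ)
    (v : ℕ) (w : AmcMessage Q n μ v) : Matrix (Fin (n - v)) (Fin (packetLength μ - v)) R :=
  ∑ i : Fin s, π ^ (i : ℕ) • Matrix.of fun (a : Fin (n - v)) (b : Fin (packetLength μ - v)) =>
    if h : (b : ℕ) < μ i - v then ((w i a ⟨b, h⟩ : Q) : R) else 0

/-- The `n × m` matrix `[0 0; 0 U]` with `v` zero rows and `v` zero columns in front of `U`. -/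
def padMatrix {R : Type*} [CommRing R] {n m : ℕ} (v : ℕ) (U : Matrix (Fin (n - v)) (Fin (m - v)) R) :
    Matrix (Fin n) (Fin m) R :=
  Matrix.of fun i j =>
    if h : v ≤ (i : ℕ) ∧ v ≤ (j : ℕ) then
      U ⟨i - v, by omega⟩ ⟨j - v, by omega⟩
    else 0

/-- The encoder. -/
def amcEncode {R : Type*} [CommRing R] (π : R) (Q : Set R) {s : ℕ} (n : ℕ) (μ : Fin s → ℕ)
    (v : ℕ) (w : AmcMessage Q n μ v) : Matrix (Fin n) (Fin (packetLength μ)) R :=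
  padMatrix v (dataMatrix π Q n μ v w)

/-- The encoding rate: `log_q` of the size of the codebook. -/
def amcRate {R : Type*} [CommRing R] (π : R) (q : ℕ) (Q : Set R) {s : ℕ} (n : ℕ)
    (μ : Fin s → ℕ) (v : ℕ) : ℝ :=
  Real.logb (q : ℝ) ((Set.range (amcEncode π Q n μ v)).ncard : ℝ)

/-- The inclusion of the first `v` indices. -/
def headIdx {n v : ℕ} (h : v ≤ n) : Fin v → Fin n := Fin.castLE h

/-- The inclusion of the last `n - v` indices. -/
def tailIdx (n v : ℕ) : Fin (n - v) → Fin n := fun i => ⟨v + i, by omega⟩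

open Classical in
/-- The decoder. Let `Y = [Y₁₁ Y₁₂; Y₂₁ Y₂₂]` with `Y₁₁` of size `v × v`. If `shape Y₁₁ ≠ t`, a
failure (`none`) is declared. Otherwise the decoder takes some `T` with `Y₂₁ = T Y₁₁` and reads the
data off the matrix `Y₂₂ - T Y₁₂`. (A failure is also declared if this is not possible.) -/
def amcDecode {R : Type*} [CommRing R] (π : R) (Q : Set R) {s : ℕ} (t : ℕ) {n : ℕ} (μ : Fin s → ℕ)
    {v : ℕ} (hn : v ≤ n) (hm : v ≤ packetLength μ)
    (Y : Matrix (Fin n) (Fin (packetLength μ)) R) : Option (AmcMessage Q n μ v) :=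
  let Y₁₁ := Y.submatrix (headIdx hn) (headIdx hm)
  let Y₁₂ := Y.submatrix (headIdx hn) (tailIdx (packetLength μ) v)
  let Y₂₁ := Y.submatrix (tailIdx n v) (headIdx hm)
  let Y₂₂ := Y.submatrix (tailIdx n v) (tailIdx (packetLength μ) v)
  if h : HasShape π (fun _ : Fin s => t) Y₁₁ ∧
      ∃ T : Matrix (Fin (n - v)) (Fin v) R, Y₂₁ = T * Y₁₁ then
    if h' : ∃ w : AmcMessage Q n μ v, dataMatrix π Q n μ v w = Y₂₂ - h.2.choose * Y₁₂ then
      some h'.choose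
    else none
  else none

/-- The probability that the decoder declares a failure when `w` is sent over the additive matrix
channel with `τ = t`. -/
def amcFailureProb {R : Type*} [CommRing R] (π : R) (Q : Set R) {s : ℕ} (t : ℕ) {n : ℕ}
    (μ : Fin s → ℕ) {v : ℕ} (hn : v ≤ n) (hm : v ≤ packetLength μ) (w : AmcMessage Q n μ v) : ℝ :=
  uniformProb (shapedMatrices π (fun _ : Fin s => t) n μ)
    {Z | amcDecode π Q t μ hn hm (amcEncode π Q n μ v w + Z) = none}

/-- The probability that the decoder outputs a wrong message when `w` is sent over the additive
matrix channel with `τ = t`. -/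
def amcErrorProb {R : Type*} [CommRing R] (π : R) (Q : Set R) {s : ℕ} (t : ℕ) {n : ℕ}
    (μ : Fin s → ℕ) {v : ℕ} (hn : v ≤ n) (hm : v ≤ packetLength μ) (w : AmcMessage Q n μ v) : ℝ :=
  uniformProb (shapedMatrices π (fun _ : Fin s => t) n μ)
    {Z | ∃ w', w' ≠ w ∧ amcDecode π Q t μ hn hm (amcEncode π Q n μ v w + Z) = some w'}

end

/-! Everything rests on the full-rank factorizations of the noise. A matrix has integer shape `t`
exactly when it is `B * E` with `B` left invertible and `E` right invertible of inner size `t`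
(`hasShape_const_iff`), and the pair is unique up to `GL_t(R)` (`ncard_factorizations`). A uniform
`Z` may thus be counted through independent uniform full-rank `B` and `E`.

Decoding: the blocks of `Y` are `B₁E₁`, `B₁E₂`, `B₂E₁` and `U + B₂E₂`. The block `B₁E₁` has shape
`t` iff `B₁` is left and `E₁` right invertible (`hasShape_mul_iff`). Then any `T` with `B₂E₁ = T
B₁E₁` satisfies `B₂ = T B₁`, because `E₁` cancels, so subtracting `T B₁E₂` leaves exactly `U`. The
decoder therefore either succeeds or declares a failure (`amcDecode_encode_add`).

Counting: one-sided invertibility can be tested modulo `π` (`IsFiniteChainRing.hasRightInv_iff`), so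
all counts reduce to full-rank matrices over the residue field, of density `fullRankProb`. The
success probability becomes `p(t,v)² / (p(t,n) p(t,μ₁))` (`amcFailureProb_eq`), and `1 - p(t,v)` is
at most a geometric sum in `q`.

Capacity: translation by a fixed matrix permutes `R^{n × μ}`, so the channel is symmetric and its
capacity is the logarithm of the size of the alphabet over the number of noise matrices
(`amcCapacity_eq`). The noise count gives `∑ (n - t)(μᵢ - t)` up to `2t`, while `n|μ|` has order
`m²`. The rate has the same form with `v` in place of `t`, so `v - t = o(m)` loses nothing in the
limit. -/

section ChainRing

/-! ### Chain rings, `π`-adic expansions and the size of `R^{n × μ}`. -/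

variable {R : Type*} [CommRing R] {π : R} {q s : ℕ}

theorem IsFiniteChainRing.pow_eq_zero (hR : IsFiniteChainRing R π q s) : π ^ s = 0 :=
  hR.nilpotency_index.1.2

theorem IsFiniteChainRing.pos (hR : IsFiniteChainRing R π q s) : 0 < s :=
  hR.nilpotency_index.1.1

theorem IsFiniteChainRing.pow_ne_zero (hR : IsFiniteChainRing R π q s) {i : ℕ} (hi : i < s) :
    π ^ i ≠ 0 := by
  intro h
  rcases Nat.eq_zero_or_pos i with rfl | h0
  · have := hR.nontrivial
    simp at h
  · exact absurd (hR.nilpotency_index.2 ⟨h0, h⟩) (by omega)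

theorem IsFiniteChainRing.isNilpotent (hR : IsFiniteChainRing R π q s) : IsNilpotent π :=
  ⟨s, hR.pow_eq_zero⟩

/-- By maximality some multiple of `a` is `1` minus a multiple of the nilpotent `π`, hence a unit.
-/
theorem IsFiniteChainRing.isUnit_of_notMem (hR : IsFiniteChainRing R π q s) {a : R}
    (ha : a ∉ Ideal.span {π}) : IsUnit a := by
  obtain ⟨b, i, hi, h⟩ := hR.isMaximal.exists_inv ha
  obtain ⟨c, rfl⟩ := Ideal.mem_span_singleton'.1 hi
  have hu : IsUnit (b * a) := by
    have : b * a = 1 - c * π := by rw [← h]; ring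
    rw [this]
    exact ((Commute.all c π).isNilpotent_mul_left hR.isNilpotent).isUnit_one_sub
  exact isUnit_of_mul_isUnit_right hu

theorem IsFiniteChainRing.two_le (hR : IsFiniteChainRing R π q s) : 2 ≤ q := by
  have := hR.finite
  have := hR.isMaximal
  have : Nontrivial (R ⧸ Ideal.span {π}) := Ideal.Quotient.nontrivial_iff.2 hR.isMaximal.ne_top
  have : Finite (R ⧸ Ideal.span {π}) := Finite.of_surjective _ Ideal.Quotient.mk_surjective
  rw [← hR.card_residueField]
  exact Finite.one_lt_card

theorem IsResidueSystem.natCard (hR : IsFiniteChainRing R π q s) {Q : Set R}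
    (hQ : IsResidueSystem π Q) : Nat.card Q = q := by
  rw [← hR.card_residueField]
  refine Nat.card_congr (Equiv.ofBijective (fun r : Q => Ideal.Quotient.mk _ (r : R)) ⟨?_, ?_⟩)
  · intro a b hab
    have h := Ideal.Quotient.eq.1 hab
    exact Subtype.ext ((hQ.existsUnique a).unique ⟨a.2, by simp⟩ ⟨b.2, h⟩)
  · intro x
    obtain ⟨a, rfl⟩ := Ideal.Quotient.mk_surjective x
    obtain ⟨r, ⟨hr, h⟩, -⟩ := hQ.existsUnique a
    exact ⟨⟨r, hr⟩, (Ideal.Quotient.eq.2 h).symm⟩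

/-! ### `π`-adic digits -/

theorem IsResidueSystem.exists_digits {Q : Set R} (hQ : IsResidueSystem π Q) (k : ℕ) (x : R) :
    ∃ d : ℕ → R, (∀ i, d i ∈ Q) ∧ ∃ y, x = ∑ i ∈ Finset.range k, π ^ i * d i + π ^ k * y := by
  induction k with
  | zero => exact ⟨fun _ => 0, fun _ => hQ.zero_mem, x, by simp⟩
  | succ k ih =>
    obtain ⟨d, hd, y, hy⟩ := ih
    obtain ⟨r, ⟨hr, h⟩, -⟩ := hQ.existsUnique y
    obtain ⟨z, hz⟩ := Ideal.mem_span_singleton'.1 h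
    refine ⟨Function.update d k r, fun i => ?_, z, ?_⟩
    · by_cases hi : i = k
      · subst hi; simpa using hr
      · simpa [hi] using hd i
    · have hs : ∑ i ∈ Finset.range k, π ^ i * Function.update d k r i =
          ∑ i ∈ Finset.range k, π ^ i * d i := by
        refine Finset.sum_congr rfl fun i hi => ?_
        rw [Function.update_of_ne (Finset.mem_range.1 hi).ne]
      have hy' : y = r + z * π := by rw [hz]; ring
      rw [Finset.sum_range_succ, hs, Function.update_self, hy, hy']
      ring

/-- At the first index `i` where the digits differ, the difference of the sums is `π ^ i` times a
unit, which is nonzero since `i < s`. -/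
theorem IsResidueSystem.digits_unique (hR : IsFiniteChainRing R π q s) {Q : Set R}
    (hQ : IsResidueSystem π Q) {d e : ℕ → R} (hd : ∀ i, d i ∈ Q) (he : ∀ i, e i ∈ Q)
    (h : ∑ i ∈ Finset.range s, π ^ i * d i = ∑ i ∈ Finset.range s, π ^ i * e i) (i : ℕ)
    (hi : i < s) : d i = e i := by
  induction i using Nat.strong_induction_on with
  | _ i ih =>
    by_contra hne
    have hnm : d i - e i ∉ Ideal.span {π} := fun hm =>
      hne ((hQ.existsUnique (d i)).unique ⟨hd i, by simp⟩ ⟨he i, hm⟩)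
    have h0 : ∑ j ∈ Finset.range s, π ^ j * (d j - e j) = 0 := by
      simp only [mul_sub, Finset.sum_sub_distrib, h, sub_self]
    have h1 : ∑ j ∈ Finset.range i, π ^ j * (d j - e j) = 0 :=
      Finset.sum_eq_zero fun j hj => by
        rw [ih j (Finset.mem_range.1 hj) ((Finset.mem_range.1 hj).trans hi), sub_self, mul_zero]
    rw [← Finset.sum_range_add_sum_Ico _ hi.le, h1, zero_add,
      Finset.sum_eq_sum_Ico_succ_bot hi] at h0
    obtain ⟨c, hc⟩ : π ^ (i + 1) ∣ ∑ j ∈ Finset.Ico (i + 1) s, π ^ j * (d j - e j) :=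
      Finset.dvd_sum fun j hj => (pow_dvd_pow π (Finset.mem_Ico.1 hj).1).mul_right _
    rw [hc] at h0
    have hu : IsUnit (d i - e i + π * c) := by
      refine hR.isUnit_of_notMem fun hm => hnm ?_
      have := Ideal.sub_mem _ hm (Ideal.mul_mem_right c _ (Ideal.mem_span_singleton_self π))
      simpa using this
    have : π ^ i * (d i - e i + π * c) = 0 := by rw [← h0]; ring
    exact hR.pow_ne_zero hi (hu.mul_left_eq_zero.1 this)

/-! ### Digit expansions of matrices -/

/-- The matrix with `π`-adic digit arrays `w i`, where the `i`-th array fills the first `μ i`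
columns. -/
def digitMatrix (π : R) (Q : Set R) {k : ℕ} (n : ℕ) (μ : Fin k → ℕ) (m : ℕ)
    (w : ∀ i : Fin k, Matrix (Fin n) (Fin (μ i)) Q) : Matrix (Fin n) (Fin m) R :=
  ∑ i : Fin k, π ^ (i : ℕ) • Matrix.of fun (a : Fin n) (b : Fin m) =>
    if h : (b : ℕ) < μ i then ((w i a ⟨b, h⟩ : Q) : R) else 0

/-- The `i`-th digit of the entry `(a, b)` of `digitMatrix`. -/
def entryDigit {Q : Set R} {k n : ℕ} {μ : Fin k → ℕ}
    (w : ∀ i : Fin k, Matrix (Fin n) (Fin (μ i)) Q) (a : Fin n) (b i : ℕ) : R :=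
  if h : ∃ hi : i < k, b < μ ⟨i, hi⟩ then ((w ⟨i, h.1⟩ a ⟨b, h.2⟩ : Q) : R) else 0

theorem digitMatrix_apply {Q : Set R} {k n m : ℕ} {μ : Fin k → ℕ}
    (w : ∀ i : Fin k, Matrix (Fin n) (Fin (μ i)) Q) (a : Fin n) (b : Fin m) :
    digitMatrix π Q n μ m w a b = ∑ i ∈ Finset.range k, π ^ i * entryDigit w a b i := by
  rw [digitMatrix, Matrix.sum_apply, Finset.sum_range]
  refine Finset.sum_congr rfl fun i _ => ?_
  simp [entryDigit]

theorem entryDigit_mem {Q : Set R} (hQ : IsResidueSystem π Q) {k n : ℕ} {μ : Fin k → ℕ}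
    (w : ∀ i : Fin k, Matrix (Fin n) (Fin (μ i)) Q) (a : Fin n) (b i : ℕ) :
    entryDigit w a b i ∈ Q := by
  unfold entryDigit
  split_ifs
  · exact Subtype.coe_prop _
  · exact hQ.zero_mem

theorem digitMatrix_injective (hR : IsFiniteChainRing R π q s) {Q : Set R}
    (hQ : IsResidueSystem π Q) {n m : ℕ} {μ : Fin s → ℕ} (hm : ∀ i, μ i ≤ m) :
    Function.Injective (digitMatrix π Q n μ m) := by
  intro w w' h
  funext i a b
  have h1 := congrFun (congrFun h a) ⟨b, b.2.trans_le (hm i)⟩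
  rw [digitMatrix_apply, digitMatrix_apply] at h1
  have h2 := hQ.digits_unique hR (entryDigit_mem hQ w a b) (entryDigit_mem hQ w' a b) h1 i i.2
  have hb : ∃ hi : (i : ℕ) < s, (b : ℕ) < μ ⟨i, hi⟩ := ⟨i.2, b.2⟩
  simp only [entryDigit, dif_pos hb] at h2
  exact Subtype.ext h2

theorem mem_rowModule {m : ℕ} {μ : Fin s → ℕ} {x : Fin m → R} :
    x ∈ rowModule π μ m ↔ ∀ j : Fin m,
      π ^ (Finset.univ.filter fun i : Fin s => μ i ≤ (j : ℕ)).card ∣ x j := by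
  simp [rowModule, Submodule.mem_pi, Ideal.mem_span_singleton]

theorem card_filter_le_of_lt {μ : Fin s → ℕ} (hμ : Monotone μ) {b : ℕ} {i : Fin s}
    (h : b < μ i) : (Finset.univ.filter fun i : Fin s => μ i ≤ b).card ≤ i := by
  rw [← Fin.card_Iio]
  refine Finset.card_le_card fun j hj => ?_
  rw [Finset.mem_Iio]
  by_contra hij
  have := hμ (not_lt.1 hij)
  simp only [Finset.mem_filter] at hj
  omega

theorem lt_card_filter_of_le {μ : Fin s → ℕ} (hμ : Monotone μ) {b : ℕ} {i : Fin s}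
    (h : μ i ≤ b) : (i : ℕ) < (Finset.univ.filter fun i : Fin s => μ i ≤ b).card := by
  rw [Nat.lt_iff_add_one_le, ← Fin.card_Iic]
  refine Finset.card_le_card fun j hj => ?_
  rw [Finset.mem_Iic] at hj
  simpa using (hμ hj).trans h

/-- Used twice: for the shape `μ - v` it identifies the codebook, and for `μ` itself it counts `R^{n
× μ}`. Divisibility of an entry by `π ^ l` amounts to the vanishing of its first `l` digits. -/
theorem range_digitMatrix (hR : IsFiniteChainRing R π q s) {Q : Set R}
    (hQ : IsResidueSystem π Q) (n : ℕ) {m : ℕ} {μ : Fin s → ℕ} (hμ : Monotone μ)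
    (hm : ∀ i, μ i ≤ m) : Set.range (digitMatrix π Q n μ m) = matrixSpace π n μ m := by
  ext X
  constructor
  · rintro ⟨w, rfl⟩ a
    refine mem_rowModule.2 fun b => ?_
    rw [digitMatrix_apply]
    refine Finset.dvd_sum fun i hi => ?_
    unfold entryDigit
    split_ifs with h
    · exact (pow_dvd_pow π (card_filter_le_of_lt hμ h.2)).mul_right _
    · simp
  · intro hX
    have key : ∀ (a : Fin n) (b : Fin m), ∃ d : ℕ → R, (∀ i, d i ∈ Q) ∧
        (∀ i : Fin s, μ i ≤ (b : ℕ) → d i = 0) ∧ X a b = ∑ i ∈ Finset.range s, π ^ i * d i := by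
      intro a b
      obtain ⟨y, hy⟩ := mem_rowModule.1 (hX a) b
      set l := (Finset.univ.filter fun i : Fin s => μ i ≤ (b : ℕ)).card with hl
      have hls : l ≤ s := (Finset.card_le_univ _).trans_eq (Fintype.card_fin s)
      obtain ⟨d, hd, z, hz⟩ := hQ.exists_digits (s - l) y
      -- The entry is `π ^ l * y`: its digits are those of `y` moved up by `l`. Only `s - l` digits
      -- of `y` matter, because the remainder is multiplied by `π ^ s = 0`.
      refine ⟨fun i => if i < l then 0 else d (i - l), fun i => ?_, fun i hi => ?_, ?_⟩
      · dsimp only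
        split_ifs
        exacts [hQ.zero_mem, hd _]
      · exact if_pos (lt_card_filter_of_le hμ hi)
      · rw [hy, hz, mul_add, ← mul_assoc, ← pow_add, Nat.add_sub_cancel' hls, hR.pow_eq_zero,
          zero_mul, add_zero, ← Finset.sum_range_add_sum_Ico _ hls,
          Finset.sum_eq_zero (s := Finset.range l) fun i hi => by
            dsimp only; rw [if_pos (Finset.mem_range.1 hi), mul_zero],
          zero_add, Finset.sum_Ico_eq_sum_range, Finset.mul_sum]
        refine Finset.sum_congr rfl fun i _ => ?_
        dsimp only
        rw [if_neg (by omega), Nat.add_sub_cancel_left, pow_add, mul_assoc]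
    choose d hd hd0 hX' using key
    refine ⟨fun i => Matrix.of fun a b => ⟨d a ⟨b, b.2.trans_le (hm i)⟩ i, hd _ _ _⟩, ?_⟩
    ext a b
    rw [digitMatrix_apply, hX']
    refine Finset.sum_congr rfl fun i hi => ?_
    unfold entryDigit
    split_ifs with h
    · rfl
    · rw [hd0 a b ⟨i, Finset.mem_range.1 hi⟩ (not_lt.1 fun hlt => h ⟨Finset.mem_range.1 hi, hlt⟩)]

theorem exists_isResidueSystem (π : R) : ∃ Q : Set R, IsResidueSystem π Q := by
  classical
  -- The zero class is treated separately since a residue system has to contain `0` itself.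
  let f : R ⧸ Ideal.span {π} → R := fun x => if x = 0 then 0 else x.out
  have hf : ∀ x, Ideal.Quotient.mk (Ideal.span {π}) (f x) = x := fun x => by
    by_cases h : x = 0
    · simp [f, h]
    · simp only [f, if_neg h]
      exact Quotient.out_eq x
  refine ⟨Set.range f, ⟨0, by simp [f]⟩, fun a => ⟨f (Ideal.Quotient.mk _ a), ⟨⟨_, rfl⟩, ?_⟩, ?_⟩⟩
  · exact Ideal.Quotient.eq.1 (hf _).symm
  · rintro _ ⟨⟨x, rfl⟩, hx⟩
    rw [Ideal.Quotient.eq.2 hx, hf]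

theorem natCard_digitArrays (hR : IsFiniteChainRing R π q s) {Q : Set R}
    (hQ : IsResidueSystem π Q) (n : ℕ) (μ : Fin s → ℕ) :
    Nat.card (∀ i : Fin s, Matrix (Fin n) (Fin (μ i)) Q) = q ^ (n * ∑ i, μ i) := by
  have := hR.finite
  have : Fintype Q := Fintype.ofFinite _
  have hq : Fintype.card Q = q := by rw [← Nat.card_eq_fintype_card, hQ.natCard hR]
  simp only [Matrix, Nat.card_eq_fintype_card, Fintype.card_pi, hq, Finset.prod_const,
    Finset.card_univ, Fintype.card_fin, ← pow_mul]
  rw [Finset.prod_pow_eq_pow_sum, Finset.mul_sum]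
  congr 1
  exact Finset.sum_congr rfl fun i _ => mul_comm _ _

theorem ncard_matrixSpace (hR : IsFiniteChainRing R π q s) (n : ℕ) {m : ℕ} {μ : Fin s → ℕ}
    (hμ : Monotone μ) (hm : ∀ i, μ i ≤ m) :
    (matrixSpace π n μ m).ncard = q ^ (n * ∑ i, μ i) := by
  obtain ⟨Q, hQ⟩ := exists_isResidueSystem π
  rw [← range_digitMatrix hR hQ n hμ hm, ← Set.image_univ,
    Set.ncard_image_of_injective _ (digitMatrix_injective hR hQ hm), Set.ncard_univ,
    natCard_digitArrays hR hQ]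

end ChainRing

/-! ### One-sided inverses and full-rank factorizations over a chain ring. -/

section MatrixInverses

variable {R : Type*} [CommRing R]

/-- The matrix `E` has a right inverse. -/
def HasRightInv {ι c : Type*} [Fintype c] [DecidableEq ι] (E : Matrix ι c R) : Prop :=
  ∃ F : Matrix c ι R, E * F = 1

/-- The matrix `B` has a left inverse. -/
def HasLeftInv {ι c : Type*} [Fintype ι] [DecidableEq c] (B : Matrix ι c R) : Prop :=
  ∃ L : Matrix c ι R, L * B = 1

theorem hasRightInv_transpose {ι c : Type*} [Fintype ι] [DecidableEq c] {B : Matrix ι c R} :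
    HasRightInv B.transpose ↔ HasLeftInv B := by
  constructor
  · rintro ⟨F, hF⟩
    refine ⟨F.transpose, ?_⟩
    rw [← Matrix.transpose_inj, Matrix.transpose_mul, Matrix.transpose_transpose, hF,
      Matrix.transpose_one]
  · rintro ⟨L, hL⟩
    exact ⟨L.transpose, by rw [← Matrix.transpose_mul, hL, Matrix.transpose_one]⟩

theorem HasRightInv.linearIndependent {ι c : Type*} [Fintype c] [Fintype ι] [DecidableEq ι]
    {E : Matrix ι c R} (h : HasRightInv E) : LinearIndependent R E.row := by
  obtain ⟨F, hF⟩ := h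
  rw [← Matrix.vecMul_injective_iff]
  intro x y hxy
  have := congrArg (fun z => Matrix.vecMul z F) hxy
  simpa [Matrix.vecMul_vecMul, hF] using this

theorem hasRightInv_of_linearIndependent_field {K : Type*} [Field K] {ι c : Type*} [Fintype c]
    [Fintype ι] [DecidableEq ι] {E : Matrix ι c K} (h : LinearIndependent K E.row) :
    HasRightInv E := by
  classical
  rw [← Matrix.vecMul_injective_iff] at h
  obtain ⟨g, hg⟩ := LinearMap.exists_leftInverse_of_injective E.vecMulLinear
    (LinearMap.ker_eq_bot.2 h)
  refine ⟨LinearMap.toMatrixRight' g, ?_⟩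
  have hE : E.vecMulLinear.toMatrixRight' = E := LinearMap.toMatrixRight'.apply_symm_apply E
  rw [← LinearMap.toMatrixRight'_id, ← hg, LinearMap.toMatrixRight'_comp, hE]

variable {π : R} {q s : ℕ}

/-- For any lift `F'` of the inverse, `det (E * F')` is `1` modulo `π`, hence a unit, and `F'` can
be corrected by the inverse of `E * F'`. -/
theorem IsFiniteChainRing.hasRightInv_of_map (hR : IsFiniteChainRing R π q s) {ι c : Type*}
    [Fintype c] [Fintype ι] [DecidableEq ι] {E : Matrix ι c R}
    (h : HasRightInv (E.map (Ideal.Quotient.mk (Ideal.span {π})))) : HasRightInv E := by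
  obtain ⟨F, hF⟩ := h
  obtain ⟨F', rfl⟩ : ∃ F' : Matrix c ι R, F'.map (Ideal.Quotient.mk (Ideal.span {π})) = F := by
    refine ⟨Matrix.of fun i j => (Ideal.Quotient.mk_surjective (F i j)).choose, ?_⟩
    ext i j
    exact (Ideal.Quotient.mk_surjective (F i j)).choose_spec
  rw [← Matrix.map_mul] at hF
  have hu : IsUnit (E * F') := by
    rw [Matrix.isUnit_iff_isUnit_det]
    refine hR.isUnit_of_notMem fun hm => ?_
    rw [← Ideal.Quotient.eq_zero_iff_mem, RingHom.map_det, RingHom.mapMatrix_apply, hF,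
      Matrix.det_one] at hm
    exact hR.isMaximal.ne_top ((Ideal.eq_top_iff_one _).2
      (Ideal.Quotient.eq_zero_iff_mem.1 (by rw [map_one]; exact hm)))
  obtain ⟨G, hG, -⟩ := isUnit_iff_exists.1 hu
  exact ⟨F' * G, by rw [← Matrix.mul_assoc, hG]⟩

/-- This turns full rank over `R` into full rank over the residue field, where the matrices can be
counted. -/
theorem IsFiniteChainRing.hasRightInv_iff (hR : IsFiniteChainRing R π q s) {ι c : Type*}
    [Fintype c] [Fintype ι] [DecidableEq ι] {E : Matrix ι c R} :
    HasRightInv E ↔ LinearIndependent (R ⧸ Ideal.span {π})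
      (E.map (Ideal.Quotient.mk (Ideal.span {π}))).row := by
  constructor
  · rintro ⟨F, hF⟩
    refine HasRightInv.linearIndependent ⟨F.map (Ideal.Quotient.mk (Ideal.span {π})), ?_⟩
    rw [← Matrix.map_mul, hF, Matrix.map_one _ (map_zero _) (map_one _)]
  · intro h
    have := hR.isMaximal
    let _ := Ideal.Quotient.field (Ideal.span {π})
    exact hR.hasRightInv_of_map (hasRightInv_of_linearIndependent_field h)

/-- A relation `x E ≡ 0` modulo `π` with some `x i` a unit would become the nontrivial relation `(π
^ (s - 1) • x) E = 0` over `R`. -/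
theorem IsFiniteChainRing.hasRightInv_of_linearIndependent (hR : IsFiniteChainRing R π q s)
    {ι c : Type*} [Fintype c] [Fintype ι] [DecidableEq ι] {E : Matrix ι c R}
    (h : LinearIndependent R E.row) : HasRightInv E := by
  rw [hR.hasRightInv_iff, ← Matrix.vecMul_injective_iff]
  rw [← Matrix.vecMul_injective_iff] at h
  have hs := hR.pos
  suffices H : ∀ x : ι → R, (∀ j, Matrix.vecMul x E j ∈ Ideal.span {π}) →
      ∀ i, x i ∈ Ideal.span {π} by
    have hinj : Function.Injective
        (E.map (Ideal.Quotient.mk (Ideal.span {π}))).vecMulLinear.toAddMonoidHom := by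
      rw [injective_iff_map_eq_zero]
      intro y hy
      obtain ⟨x, rfl⟩ : ∃ x : ι → R, Ideal.Quotient.mk (Ideal.span {π}) ∘ x = y :=
        ⟨fun i => (Ideal.Quotient.mk_surjective (y i)).choose,
          funext fun i => (Ideal.Quotient.mk_surjective (y i)).choose_spec⟩
      funext i
      refine Ideal.Quotient.eq_zero_iff_mem.2 (H x (fun j => ?_) i)
      rw [← Ideal.Quotient.eq_zero_iff_mem, RingHom.map_vecMul]
      exact congrFun hy j
    exact hinj
  intro x hx i
  by_contra hi
  have hu := hR.isUnit_of_notMem hi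
  have h0 : Matrix.vecMul (π ^ (s - 1) • x) E = Matrix.vecMul 0 E := by
    rw [Matrix.smul_vecMul, Matrix.zero_vecMul]
    funext j
    obtain ⟨c, hc⟩ := Ideal.mem_span_singleton.1 (hx j)
    rw [Pi.smul_apply, hc, smul_eq_mul, ← mul_assoc, ← pow_succ, Nat.sub_add_cancel hs,
      hR.pow_eq_zero, zero_mul, Pi.zero_apply]
  have h1 := congrFun (h h0) i
  exact hR.pow_ne_zero (Nat.sub_lt hs one_pos) (hu.mul_left_eq_zero.1 h1)

theorem packetLength_const (hs : 0 < s) (t : ℕ) : packetLength (fun _ : Fin s => t) = t := by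
  have : Nonempty (Fin s) := ⟨⟨0, hs⟩⟩
  exact Finset.sup_const Finset.univ_nonempty t

theorem mem_rowModule_of_le {m : ℕ} {μ : Fin s → ℕ} (hμ : ∀ i, m ≤ μ i) (x : Fin m → R) :
    x ∈ rowModule π μ m := by
  rw [mem_rowModule]
  intro j
  rw [Finset.filter_false_of_mem fun i _ => by have := hμ i; omega]
  simp

/-- `R^t` for an integer `t` is the free module of rank `t`. -/
def shapeModuleConstEquiv (π : R) (hs : 0 < s) (t : ℕ) :
    shapeModule π (fun _ : Fin s => t) ≃ₗ[R] (Fin t → R) :=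
  (LinearEquiv.ofTop _ (eq_top_iff.2 fun x _ =>
    mem_rowModule_of_le (fun _ => (packetLength_const hs t).le) x)).trans
    (LinearEquiv.funCongrLeft R R (finCongr (packetLength_const hs t).symm))

/-- A matrix has the integer shape `t` iff it has a full-rank factorization of rank `t`. -/
theorem hasShape_const_iff (hR : IsFiniteChainRing R π q s) {t : ℕ} {ι c : Type*} [Fintype ι]
    [Fintype c] {A : Matrix ι c R} :
    HasShape π (fun _ : Fin s => t) A ↔ ∃ (B : Matrix ι (Fin t) R) (E : Matrix (Fin t) c R),
      A = B * E ∧ HasLeftInv B ∧ HasRightInv E := by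
  classical
  constructor
  · rintro ⟨-, ⟨e⟩⟩
    let f := e.trans (shapeModuleConstEquiv π hR.pos t)
    -- The rows of `E` are a basis of the row span, and the rows of `B` are the coordinates of the
    -- rows of `A` in it. Writing the basis in terms of the rows of `A` gives the left inverse of
    -- `B`.
    let E : Matrix (Fin t) c R := Matrix.of fun i => (f.symm (Pi.single i 1) : c → R)
    let B : Matrix ι (Fin t) R := Matrix.of fun k => f ⟨A k, Submodule.subset_span ⟨k, rfl⟩⟩
    have hvE : ∀ x : Fin t → R, Matrix.vecMul x E = (f.symm x : c → R) := by
      intro x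
      conv_rhs => rw [pi_eq_sum_univ' x]
      rw [Matrix.vecMul_eq_sum, map_sum, AddSubmonoidClass.coe_finsetSum]
      refine Finset.sum_congr rfl fun i _ => ?_
      rw [map_smul]
      rfl
    have hinj : Function.Injective fun x : Fin t → R => Matrix.vecMul x E := by
      intro x y hxy
      simp only [hvE] at hxy
      exact f.symm.injective (Subtype.ext hxy)
    have hA : A = B * E := by
      ext k j
      rw [Matrix.mul_apply_eq_vecMul, hvE]
      have : f.symm (B k) = ⟨A k, Submodule.subset_span ⟨k, rfl⟩⟩ := f.symm_apply_apply _
      rw [this]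
    have hL : ∀ i, ∃ l : ι → R, Matrix.vecMul l A = E i := by
      intro i
      obtain ⟨l, hl⟩ := (Submodule.mem_span_range_iff_exists_fun R).1
        (f.symm (Pi.single i 1)).2
      exact ⟨l, by rw [Matrix.vecMul_eq_sum]; exact hl⟩
    choose l hl using hL
    refine ⟨B, E, hA, ⟨Matrix.of l, ?_⟩, hR.hasRightInv_of_linearIndependent
      (Matrix.vecMul_injective_iff.1 hinj)⟩
    have h1 : Matrix.of l * B * E = (1 : Matrix (Fin t) (Fin t) R) * E := by
      rw [Matrix.mul_assoc, ← hA, Matrix.one_mul]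
      ext i j
      rw [Matrix.mul_apply_eq_vecMul]
      exact congrFun (hl i) j
    funext i
    apply hinj
    have h2 := congrFun h1 i
    rwa [Matrix.mul_apply_eq_vecMul, Matrix.mul_apply_eq_vecMul] at h2
  · rintro ⟨B, E, rfl, ⟨L, hL⟩, hE⟩
    refine ⟨monotone_const, ⟨?_⟩⟩
    have hinj := Matrix.vecMul_injective_iff.2 hE.linearIndependent
    have hspan : Submodule.span R (Set.range fun i => (B * E) i) =
        LinearMap.range E.vecMulLinear := by
      change Submodule.span R (Set.range (B * E).row) = _
      rw [← range_vecMulLinear]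
      apply le_antisymm
      · rintro _ ⟨x, rfl⟩
        exact ⟨Matrix.vecMul x B, by simp [Matrix.vecMul_vecMul]⟩
      · rintro _ ⟨x, rfl⟩
        exact ⟨Matrix.vecMul x L, by simp [Matrix.vecMul_vecMul, ← Matrix.mul_assoc, hL]⟩
    exact (LinearEquiv.ofEq _ _ hspan).trans
      ((LinearEquiv.ofInjective E.vecMulLinear hinj).symm.trans
        (shapeModuleConstEquiv π hR.pos t).symm)

/-- A product through `R^t` has shape `t` iff both factors have full rank. -/
theorem hasShape_mul_iff (hR : IsFiniteChainRing R π q s) {t : ℕ} {ι c : Type*} [Fintype ι]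
    [Fintype c] {B : Matrix ι (Fin t) R} {E : Matrix (Fin t) c R} :
    HasShape π (fun _ : Fin s => t) (B * E) ↔ HasLeftInv B ∧ HasRightInv E := by
  rw [hasShape_const_iff hR]
  constructor
  · rintro ⟨B', E', h, ⟨L, hL⟩, ⟨F, hF⟩⟩
    have h1 : (L * B) * (E * F) = 1 := by
      rw [Matrix.mul_assoc, ← Matrix.mul_assoc B, h, Matrix.mul_assoc, hF, Matrix.mul_one, hL]
    -- `L * B` and `E * F` are both `t × t`, so a one-sided inverse is two-sided.
    have h2 := mul_eq_one_comm.1 h1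
    exact ⟨⟨E * F * L, by rw [Matrix.mul_assoc, h2]⟩, ⟨F * (L * B), by rw [← Matrix.mul_assoc, h2]⟩⟩
  · rintro ⟨hB, hE⟩
    exact ⟨B, E, rfl, hB, hE⟩

end MatrixInverses

/-! ### Encoder and decoder: rate, correctness and the failure criterion. -/

section Decoder

variable {R : Type*} [CommRing R] {π : R} {q s : ℕ}

theorem padMatrix_submatrix_head_left {n m v : ℕ} (hn : v ≤ n)
    (U : Matrix (Fin (n - v)) (Fin (m - v)) R) {l : Type*} (f : l → Fin m) :
    (padMatrix v U).submatrix (headIdx hn) f = 0 := by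
  ext i j
  simp only [padMatrix, headIdx, Matrix.submatrix_apply, Matrix.of_apply, Matrix.zero_apply]
  rw [dif_neg]
  simp

theorem padMatrix_submatrix_head_right {n m v : ℕ} (hm : v ≤ m)
    (U : Matrix (Fin (n - v)) (Fin (m - v)) R) {l : Type*} (f : l → Fin n) :
    (padMatrix v U).submatrix f (headIdx hm) = 0 := by
  ext i j
  simp only [padMatrix, headIdx, Matrix.submatrix_apply, Matrix.of_apply, Matrix.zero_apply]
  rw [dif_neg]
  simp

theorem padMatrix_submatrix_tail {n m v : ℕ} (U : Matrix (Fin (n - v)) (Fin (m - v)) R) :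
    (padMatrix v U).submatrix (tailIdx n v) (tailIdx m v) = U := by
  ext i j
  simp [padMatrix, tailIdx]

theorem padMatrix_injective {n m v : ℕ} :
    Function.Injective (padMatrix v : Matrix (Fin (n - v)) (Fin (m - v)) R → _) := by
  intro U U' h
  rw [← padMatrix_submatrix_tail U, h, padMatrix_submatrix_tail]

theorem le_packetLength {μ : Fin s → ℕ} (i : Fin s) : μ i ≤ packetLength μ :=
  Finset.le_sup (Finset.mem_univ i)

theorem dataMatrix_injective (hR : IsFiniteChainRing R π q s) {Q : Set R}
    (hQ : IsResidueSystem π Q) (n : ℕ) (μ : Fin s → ℕ) (v : ℕ) :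
    Function.Injective (dataMatrix π Q n μ v) :=
  digitMatrix_injective hR hQ fun i => Nat.sub_le_sub_right (le_packetLength i) v

theorem range_dataMatrix (hR : IsFiniteChainRing R π q s) {Q : Set R}
    (hQ : IsResidueSystem π Q) (n : ℕ) {μ : Fin s → ℕ} (hμ : Monotone μ) (v : ℕ) :
    Set.range (dataMatrix π Q n μ v) =
      matrixSpace π (n - v) (fun i => μ i - v) (packetLength μ - v) :=
  range_digitMatrix hR hQ (n - v) (fun _ _ h => Nat.sub_le_sub_right (hμ h) v)
    fun i => Nat.sub_le_sub_right (le_packetLength i) v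

theorem amcEncode_injective (hR : IsFiniteChainRing R π q s) {Q : Set R}
    (hQ : IsResidueSystem π Q) (n : ℕ) (μ : Fin s → ℕ) (v : ℕ) :
    Function.Injective (amcEncode π Q n μ v) :=
  padMatrix_injective.comp (dataMatrix_injective hR hQ n μ v)

theorem range_amcEncode (hR : IsFiniteChainRing R π q s) {Q : Set R}
    (hQ : IsResidueSystem π Q) (n : ℕ) {μ : Fin s → ℕ} (hμ : Monotone μ) (v : ℕ) :
    Set.range (amcEncode π Q n μ v) =
      padMatrix v '' matrixSpace π (n - v) (fun i => μ i - v) (packetLength μ - v) := by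
  rw [← range_dataMatrix hR hQ n hμ v, ← Set.range_comp]
  rfl

theorem padMatrix_mem_matrixSpace {n m v : ℕ} {μ : Fin s → ℕ}
    {U : Matrix (Fin (n - v)) (Fin (m - v)) R}
    (hU : U ∈ matrixSpace π (n - v) (fun i => μ i - v) (m - v)) :
    padMatrix v U ∈ matrixSpace π n μ m := by
  intro i
  rw [mem_rowModule]
  intro j
  simp only [padMatrix, Matrix.of_apply]
  split_ifs with h
  · have hc := mem_rowModule.1 (hU ⟨i - v, by omega⟩) ⟨j - v, by omega⟩
    refine (pow_dvd_pow π (Finset.card_le_card fun i hi => ?_)).trans hc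
    simp only [Finset.mem_filter, Finset.mem_univ, true_and] at hi ⊢
    omega
  · exact dvd_zero _

theorem amcEncode_mem (hR : IsFiniteChainRing R π q s) {Q : Set R}
    (hQ : IsResidueSystem π Q) (n : ℕ) {μ : Fin s → ℕ} (hμ : Monotone μ) (v : ℕ)
    (w : AmcMessage Q n μ v) : amcEncode π Q n μ v w ∈ matrixSpace π n μ (packetLength μ) := by
  refine padMatrix_mem_matrixSpace ?_
  rw [← range_dataMatrix hR hQ n hμ v]
  exact ⟨w, rfl⟩

theorem amcRate_eq (hR : IsFiniteChainRing R π q s) {Q : Set R} (hQ : IsResidueSystem π Q)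
    {n v : ℕ} {μ : Fin s → ℕ} (hn : v ≤ n) (hv : ∀ i, v ≤ μ i) :
    amcRate π q Q n μ v = ∑ i, ((n : ℝ) - v) * ((μ i : ℝ) - v) := by
  have hq := hR.two_le
  rw [amcRate, ← Set.image_univ, Set.ncard_image_of_injective _ (amcEncode_injective hR hQ n μ v),
    Set.ncard_univ, AmcMessage, natCard_digitArrays hR hQ, Nat.cast_pow, Real.logb_pow,
    Real.logb_self_eq_one (by exact_mod_cast hq), mul_one, Nat.cast_mul, Nat.cast_sub hn,
    Nat.cast_sum, Finset.mul_sum]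
  exact Finset.sum_congr rfl fun i _ => by rw [Nat.cast_sub (hv i)]

/-- If the error matrix is `B * E` with full-rank factors, then the decoder recovers the message
when the leading `v × v` block of the error matrix has full rank, and fails otherwise. -/
theorem amcDecode_encode_add (hR : IsFiniteChainRing R π q s) {Q : Set R}
    (hQ : IsResidueSystem π Q) {n t v : ℕ} {μ : Fin s → ℕ} (hn : v ≤ n) (hm : v ≤ packetLength μ)
    (w : AmcMessage Q n μ v) (B : Matrix (Fin n) (Fin t) R)
    (E : Matrix (Fin t) (Fin (packetLength μ)) R) :
    (HasShape π (fun _ : Fin s => t) (B.submatrix (headIdx hn) id * E.submatrix id (headIdx hm)) →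
      amcDecode π Q t μ hn hm (amcEncode π Q n μ v w + B * E) = some w) ∧
    (¬ HasShape π (fun _ : Fin s => t)
        (B.submatrix (headIdx hn) id * E.submatrix id (headIdx hm)) →
      amcDecode π Q t μ hn hm (amcEncode π Q n μ v w + B * E) = none) := by
  have hsub : ∀ {k l : Type} (f : k → Fin n) (g : l → Fin (packetLength μ)),
      (amcEncode π Q n μ v w + B * E).submatrix f g =
        (amcEncode π Q n μ v w).submatrix f g + B.submatrix f id * E.submatrix id g :=
    fun f g => by ext i j; simp [Matrix.mul_apply]
  have h11 : (amcEncode π Q n μ v w + B * E).submatrix (headIdx hn) (headIdx hm) =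
      B.submatrix (headIdx hn) id * E.submatrix id (headIdx hm) := by
    rw [hsub, amcEncode, padMatrix_submatrix_head_left, zero_add]
  constructor
  · intro h
    obtain ⟨⟨L, hL⟩, F, hF⟩ := (hasShape_mul_iff hR).1 h
    have hT : ∃ T : Matrix (Fin (n - v)) (Fin v) R,
        (amcEncode π Q n μ v w + B * E).submatrix (tailIdx n v) (headIdx hm) =
          T * (amcEncode π Q n μ v w + B * E).submatrix (headIdx hn) (headIdx hm) := by
      refine ⟨B.submatrix (tailIdx n v) id * L, ?_⟩
      rw [h11, hsub, amcEncode, padMatrix_submatrix_head_right, zero_add, Matrix.mul_assoc,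
        ← Matrix.mul_assoc L, hL, Matrix.one_mul]
    have hdata : ∀ T : Matrix (Fin (n - v)) (Fin v) R,
        (amcEncode π Q n μ v w + B * E).submatrix (tailIdx n v) (headIdx hm) =
          T * (amcEncode π Q n μ v w + B * E).submatrix (headIdx hn) (headIdx hm) →
        (amcEncode π Q n μ v w + B * E).submatrix (tailIdx n v) (tailIdx (packetLength μ) v) -
          T * (amcEncode π Q n μ v w + B * E).submatrix (headIdx hn)
            (tailIdx (packetLength μ) v) = dataMatrix π Q n μ v w := by
      intro T hT
      rw [h11, hsub, amcEncode, padMatrix_submatrix_head_right, zero_add] at hT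
      -- Multiplying by the right inverse `F` cancels `E₁`. This holds for every admissible `T`, so
      -- the choice made by the decoder is irrelevant.
      have hB : B.submatrix (tailIdx n v) id = T * B.submatrix (headIdx hn) id := by
        have := congrArg (· * F) hT
        simpa only [Matrix.mul_assoc, hF, Matrix.mul_one] using this
      rw [hsub, hsub, amcEncode, padMatrix_submatrix_head_left, padMatrix_submatrix_tail, zero_add,
        hB, Matrix.mul_assoc, add_sub_cancel_right]
    unfold amcDecode
    simp only
    have hc : HasShape π (fun _ : Fin s => t)
          ((amcEncode π Q n μ v w + B * E).submatrix (headIdx hn) (headIdx hm)) ∧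
        ∃ T : Matrix (Fin (n - v)) (Fin v) R,
        (amcEncode π Q n μ v w + B * E).submatrix (tailIdx n v) (headIdx hm) =
          T * (amcEncode π Q n μ v w + B * E).submatrix (headIdx hn) (headIdx hm) :=
      ⟨by rwa [h11], hT⟩
    have hw : ∃ w' : AmcMessage Q n μ v, dataMatrix π Q n μ v w' =
        (amcEncode π Q n μ v w + B * E).submatrix (tailIdx n v) (tailIdx (packetLength μ) v) -
          hc.2.choose * (amcEncode π Q n μ v w + B * E).submatrix (headIdx hn)
            (tailIdx (packetLength μ) v) :=
      ⟨w, (hdata _ hc.2.choose_spec).symm⟩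
    rw [dif_pos hc, dif_pos hw]
    congr 1
    exact dataMatrix_injective hR hQ n μ v (hw.choose_spec.trans (hdata _ hc.2.choose_spec))
  · intro h
    unfold amcDecode
    simp only
    rw [dif_neg]
    rintro ⟨h', -⟩
    rw [h11] at h'
    exact h h'

theorem amcDecode_eq_none_iff (hR : IsFiniteChainRing R π q s) {Q : Set R}
    (hQ : IsResidueSystem π Q) {n t v : ℕ} {μ : Fin s → ℕ} (hn : v ≤ n) (hm : v ≤ packetLength μ)
    (w : AmcMessage Q n μ v) (B : Matrix (Fin n) (Fin t) R)
    (E : Matrix (Fin t) (Fin (packetLength μ)) R) :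
    amcDecode π Q t μ hn hm (amcEncode π Q n μ v w + B * E) = none ↔
      ¬ HasShape π (fun _ : Fin s => t)
        (B.submatrix (headIdx hn) id * E.submatrix id (headIdx hm)) := by
  refine ⟨fun h hs => ?_, (amcDecode_encode_add hR hQ hn hm w B E).2⟩
  rw [(amcDecode_encode_add hR hQ hn hm w B E).1 hs] at h
  exact Option.some_ne_none _ h

theorem amcErrorProb_eq_zero (hR : IsFiniteChainRing R π q s) {Q : Set R}
    (hQ : IsResidueSystem π Q) {n t v : ℕ} {μ : Fin s → ℕ} (hn : v ≤ n) (hm : v ≤ packetLength μ)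
    (w : AmcMessage Q n μ v) : amcErrorProb π Q t μ hn hm w = 0 := by
  rw [amcErrorProb, uniformProb]
  have : shapedMatrices π (fun _ : Fin s => t) n μ ∩
      {Z | ∃ w', w' ≠ w ∧ amcDecode π Q t μ hn hm (amcEncode π Q n μ v w + Z) = some w'} = ∅ := by
    rw [Set.eq_empty_iff_forall_notMem]
    rintro _ ⟨⟨-, hZ⟩, w', hne, hw'⟩
    obtain ⟨B, E, rfl, -, -⟩ := (hasShape_const_iff hR).1 hZ
    have := amcDecode_encode_add hR hQ hn hm w B E
    by_cases h : HasShape π (fun _ : Fin s => t)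
        (B.submatrix (headIdx hn) id * E.submatrix id (headIdx hm))
    · rw [this.1 h] at hw'
      exact hne (Option.some.inj hw').symm
    · rw [this.2 h] at hw'
      exact Option.some_ne_none _ hw'.symm
  rw [this]
  simp

theorem shapedMatrices_const_nonempty (hR : IsFiniteChainRing R π q s) {n t : ℕ} {μ : Fin s → ℕ}
    (hn : t ≤ n) (hμ : ∀ i, t ≤ μ i) : (shapedMatrices π (fun _ : Fin s => t) n μ).Nonempty := by
  have hm := hR.le_packetLength hμ
  have hinj : ∀ {k : ℕ} (h : t ≤ k),
      ((1 : Matrix (Fin k) (Fin k) R).submatrix (headIdx h) id) *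
        ((1 : Matrix (Fin k) (Fin k) R).submatrix id (headIdx h)) = 1 := fun {k} h => by
    rw [← Matrix.submatrix_mul _ _ _ _ _ Function.bijective_id, Matrix.one_mul]
    exact Matrix.submatrix_one _ (Fin.castLE_injective h)
  -- The witness has `I_t` in the top left corner and zeros elsewhere; since `t ≤ μ i` for all `i`,
  -- its nonzero columns are subject to no divisibility condition.
  refine ⟨(1 : Matrix (Fin n) (Fin n) R).submatrix id (headIdx hn) *
    (1 : Matrix (Fin (packetLength μ)) (Fin (packetLength μ)) R).submatrix (headIdx hm) id, ?_,
    (hasShape_mul_iff hR).2 ⟨⟨_, hinj hn⟩, ⟨_, hinj hm⟩⟩⟩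
  intro i
  rw [mem_rowModule]
  intro j
  rw [Matrix.mul_apply]
  refine Finset.dvd_sum fun l _ => Dvd.dvd.mul_left ?_ _
  by_cases hl : headIdx hm l = j
  · subst hl
    rw [Finset.filter_false_of_mem fun i _ => by
      have := hμ i
      have := l.2
      simp only [headIdx, Fin.val_castLE]
      omega]
    simp
  · rw [Matrix.submatrix_apply, id, Matrix.one_apply_ne hl]
    exact dvd_zero _

end Decoder

/-! ### Counting full-rank matrices and factorizations. -/

section Counting

/-- The preimage of a set under a surjective homomorphism of finite groups has the same density. -/
theorem AddMonoidHom.natCard_preimage_mul {G H : Type*} [AddCommGroup G] [AddCommGroup H]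
    (f : G →+ H) (hf : Function.Surjective f) (p : H → Prop) :
    Nat.card {g // p (f g)} * Nat.card H = Nat.card {h // p h} * Nat.card G := by
  obtain ⟨σ, hσ⟩ := hf.hasRightInverse
  have key : ∀ p : H → Prop, Nat.card {g // p (f g)} = Nat.card {h // p h} * Nat.card f.ker := by
    intro p
    rw [← Nat.card_prod]
    exact Nat.card_congr
      -- A set-theoretic section `σ` splits the preimage as a product with the kernel.
      { toFun := fun g => (⟨f g, g.2⟩, ⟨g - σ (f g), by simp [AddMonoidHom.mem_ker, hσ (f g)]⟩)
        invFun := fun x => ⟨x.2 + σ x.1, by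
          rw [map_add, AddMonoidHom.mem_ker.1 x.2.2, hσ, zero_add]; exact x.1.2⟩
        left_inv := fun g => by simp
        right_inv := fun x => by
          have h0 : f (x.2 : G) = 0 := AddMonoidHom.mem_ker.1 x.2.2
          ext <;> simp [h0, hσ (x.1 : H)] }
  have h1 := key p
  have h2 : Nat.card G = Nat.card H * Nat.card f.ker := by
    have h := key fun _ => True
    rwa [Nat.card_congr (Equiv.subtypeUnivEquiv fun _ => trivial),
      Nat.card_congr (Equiv.subtypeUnivEquiv fun _ => trivial)] at h
  rw [h1, h2]
  ring

/-- The probability that a uniform `t × v` matrix over a field of size `q` has rank `t`. -/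
noncomputable def fullRankProb (q t v : ℕ) : ℝ := ∏ i ∈ Finset.range t, (1 - (q : ℝ) ^ i / (q : ℝ) ^ v)

variable {R : Type*} [CommRing R] {π : R} {q s : ℕ}

theorem natCard_linearIndependent_residue (hR : IsFiniteChainRing R π q s) {t v : ℕ} (h : t ≤ v) :
    (Nat.card {M : Fin t → Fin v → R ⧸ Ideal.span {π} //
      LinearIndependent (R ⧸ Ideal.span {π}) M} : ℝ) = (q : ℝ) ^ (t * v) * fullRankProb q t v := by
  have := hR.finite
  have := hR.isMaximal
  let _ := Ideal.Quotient.field (Ideal.span {π})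
  have : Finite (R ⧸ Ideal.span {π}) := Finite.of_surjective _ Ideal.Quotient.mk_surjective
  let _ : Fintype (R ⧸ Ideal.span {π}) := Fintype.ofFinite _
  have hq : Fintype.card (R ⧸ Ideal.span {π}) = q := by
    rw [← Nat.card_eq_fintype_card, hR.card_residueField]
  have hq2 := hR.two_le
  have hq0 : (q : ℝ) ≠ 0 := by positivity
  have := card_linearIndependent (K := R ⧸ Ideal.span {π}) (V := Fin v → R ⧸ Ideal.span {π})
    (k := t) (by simpa using h)
  have h1 : Nat.card {M : Fin t → Fin v → R ⧸ Ideal.span {π} //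
      LinearIndependent (R ⧸ Ideal.span {π}) M} = ∏ i ∈ Finset.range t, (q ^ v - q ^ i) := by
    rw [hq, Module.finrank_fin_fun] at this
    rw [Finset.prod_range]
    exact this
  rw [h1, fullRankProb, mul_comm t v, pow_mul, Nat.cast_prod]
  conv_rhs => rw [← Finset.card_range t, ← Finset.prod_const, Finset.card_range,
    ← Finset.prod_mul_distrib]
  refine Finset.prod_congr rfl fun i hi => ?_
  have hi' : i ≤ v := (Finset.mem_range.1 hi).le.trans h
  rw [Nat.cast_sub (Nat.pow_le_pow_right (by omega) hi')]
  push_cast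
  field_simp

/-- The number of `t`-row matrices in `R^{t × μ}` whose first `v` columns have full rank. -/
theorem ncard_hasRightInv_head (hR : IsFiniteChainRing R π q s) {t v m : ℕ} {μ : Fin s → ℕ}
    (hμ : Monotone μ) (hm : ∀ i, μ i ≤ m) (htv : t ≤ v) (hv : ∀ i, v ≤ μ i) (hvm : v ≤ m) :
    (({E | E ∈ matrixSpace π t μ m ∧ HasRightInv (E.submatrix id (headIdx hvm))} :
      Set (Matrix (Fin t) (Fin m) R)).ncard : ℝ) =
      (q : ℝ) ^ (t * ∑ i, μ i) * fullRankProb q t v := by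
  have := hR.finite
  have := hR.isMaximal
  have hfin : Finite (R ⧸ Ideal.span {π}) := Finite.of_surjective _ Ideal.Quotient.mk_surjective
  have hq2 := hR.two_le
  have hq0 : (q : ℝ) ≠ 0 := by positivity
  let K := R ⧸ Ideal.span {π}
  -- Reduction modulo `π` of the first `v` columns. It is surjective because `v ≤ μ i` leaves these
  -- columns unconstrained, so the density can be computed over the residue field.
  let f : (Fin t → rowModule π μ m) →+ (Fin t → Fin v → K) :=
    { toFun := fun g i j => Ideal.Quotient.mk _ ((g i : Fin m → R) (headIdx hvm j))
      map_zero' := by ext; simp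
      map_add' := fun g g' => by ext; simp }
  have hf : Function.Surjective f := by
    intro M
    choose r hr using fun i j => Ideal.Quotient.mk_surjective (M i j)
    refine ⟨fun i => ⟨fun j => if h : (j : ℕ) < v then r i ⟨j, h⟩ else 0, ?_⟩, ?_⟩
    · rw [mem_rowModule]
      intro j
      split_ifs with h
      · rw [Finset.filter_false_of_mem fun i _ => by have := hv i; omega]
        simp
      · exact dvd_zero _
    · funext i j
      simp [f, headIdx, hr]
  have h1 := f.natCard_preimage_mul hf fun M => LinearIndependent K M
  have hset : Nat.card {g // LinearIndependent K (f g)} =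
      ({E | E ∈ matrixSpace π t μ m ∧ HasRightInv (E.submatrix id (headIdx hvm))} :
        Set (Matrix (Fin t) (Fin m) R)).ncard := by
    rw [← Nat.card_coe_set_eq]
    refine Nat.card_congr
      { toFun := fun g => ⟨Matrix.of fun i => (g.1 i : Fin m → R), fun i => (g.1 i).2,
          hR.hasRightInv_iff.2 g.2⟩
        invFun := fun E => ⟨fun i => ⟨E.1 i, E.2.1 i⟩, hR.hasRightInv_iff.1 E.2.2⟩
        left_inv := fun g => rfl
        right_inv := fun E => rfl }
  have hG : Nat.card (Fin t → rowModule π μ m) = q ^ (t * ∑ i, μ i) := by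
    rw [← ncard_matrixSpace hR t hμ hm, ← Nat.card_coe_set_eq]
    exact Nat.card_congr
      { toFun := fun g => ⟨Matrix.of fun i => (g i : Fin m → R), fun i => (g i).2⟩
        invFun := fun E i => ⟨E.1 i, E.2 i⟩
        left_inv := fun g => rfl
        right_inv := fun E => rfl }
  have hH : Nat.card (Fin t → Fin v → K) = q ^ (t * v) := by
    rw [Nat.card_fun, Nat.card_fun, hR.card_residueField, Nat.card_fin, Nat.card_fin, ← pow_mul,
      mul_comm]
  rw [hset, hG, hH] at h1
  have h2 := congrArg (Nat.cast : ℕ → ℝ) h1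
  push_cast at h2
  rw [natCard_linearIndependent_residue hR htv] at h2
  have h3 : (q : ℝ) ^ (t * v) ≠ 0 := pow_ne_zero _ hq0
  apply mul_right_cancel₀ h3
  rw [h2]
  ring

/-- In `R^{t × μ}`, only the first `μ₁` columns matter for having full rank. -/
theorem hasRightInv_head_iff (hR : IsFiniteChainRing R π q s) {t m : ℕ} {μ : Fin s → ℕ}
    (hm : μ ⟨0, hR.pos⟩ ≤ m) {E : Matrix (Fin t) (Fin m) R} (hE : E ∈ matrixSpace π t μ m) :
    HasRightInv (E.submatrix id (headIdx hm)) ↔ HasRightInv E := by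
  constructor
  · rintro ⟨F, hF⟩
    refine ⟨(1 : Matrix (Fin m) (Fin m) R).submatrix id (headIdx hm) * F, ?_⟩
    rw [← hF, ← Matrix.mul_assoc]
    congr 1
    ext i j
    simp [Matrix.mul_apply, Matrix.one_apply]
  · intro h
    rw [hR.hasRightInv_iff, ← Matrix.vecMul_injective_iff] at h ⊢
    intro x y hxy
    refine h (funext fun j => ?_)
    by_cases hj : (j : ℕ) < μ ⟨0, hR.pos⟩
    · exact congrFun hxy ⟨j, hj⟩
    -- From column `μ₁` on, all entries are divisible by `π` and vanish in the residue field.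
    · have h0 : ∀ i, Ideal.Quotient.mk (Ideal.span {π}) (E i j) = 0 := fun i => by
        rw [Ideal.Quotient.eq_zero_iff_mem, Ideal.mem_span_singleton]
        refine (dvd_pow_self π ?_).trans (mem_rowModule.1 (hE i) j)
        exact Finset.card_ne_zero.2 ⟨⟨0, hR.pos⟩, by simpa using hj⟩
      simp [Matrix.vecMul, dotProduct, h0]

theorem mem_matrixSpace_of_le {n m : ℕ} {μ : Fin s → ℕ} (h : ∀ i, m ≤ μ i)
    (E : Matrix (Fin n) (Fin m) R) : E ∈ matrixSpace π n μ m :=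
  fun i => mem_rowModule_of_le h (E i)

/-- The number of `n × t` matrices whose first `v` rows have full rank. -/
theorem ncard_hasLeftInv_head (hR : IsFiniteChainRing R π q s) {t v n : ℕ} (htv : t ≤ v)
    (hvn : v ≤ n) :
    (({B | HasLeftInv (B.submatrix (headIdx hvn) id)} : Set (Matrix (Fin n) (Fin t) R)).ncard : ℝ) =
      (q : ℝ) ^ (s * n * t) * fullRankProb q t v := by
  -- Transposition reduces to right inverses; the constant shape `n` imposes no divisibility.
  have h := ncard_hasRightInv_head hR (μ := fun _ => n) (m := n) monotone_const (fun _ => le_rfl)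
    htv (fun _ => hvn) hvn
  have he : t * ∑ _i : Fin s, n = s * n * t := by simp [mul_comm]
  rw [he] at h
  rw [← h, ← Set.ncard_image_of_injective _ Matrix.transpose_injective]
  congr 2
  ext E
  constructor
  · rintro ⟨B, hB, rfl⟩
    exact ⟨mem_matrixSpace_of_le (fun _ => le_rfl) _, hasRightInv_transpose.2 hB⟩
  · rintro ⟨-, hE⟩
    exact ⟨E.transpose, hasRightInv_transpose.1 hE, E.transpose_transpose⟩

theorem ncard_hasLeftInv (hR : IsFiniteChainRing R π q s) {t n : ℕ} (htn : t ≤ n) :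
    (({B | HasLeftInv B} : Set (Matrix (Fin n) (Fin t) R)).ncard : ℝ) =
      (q : ℝ) ^ (s * n * t) * fullRankProb q t n :=
  ncard_hasLeftInv_head hR htn le_rfl

theorem ncard_hasRightInv (hR : IsFiniteChainRing R π q s) {t m : ℕ} {μ : Fin s → ℕ}
    (hμ : Monotone μ) (hm : ∀ i, μ i ≤ m) (ht : ∀ i, t ≤ μ i) :
    (({E | E ∈ matrixSpace π t μ m ∧ HasRightInv E} : Set (Matrix (Fin t) (Fin m) R)).ncard : ℝ) =
      (q : ℝ) ^ (t * ∑ i, μ i) * fullRankProb q t (μ ⟨0, hR.pos⟩) := by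
  rw [← ncard_hasRightInv_head hR hμ hm (ht _) (fun i => hμ (Nat.zero_le _)) (hm _)]
  congr 2
  ext E
  exact and_congr_right fun hE => (hasRightInv_head_iff hR (hm _) hE).symm

theorem natCard_units_matrix (hR : IsFiniteChainRing R π q s) (t : ℕ) :
    (Nat.card (Matrix (Fin t) (Fin t) R)ˣ : ℝ) = (q : ℝ) ^ (s * t * t) * fullRankProb q t t := by
  rw [← ncard_hasLeftInv hR le_rfl, ← Nat.card_coe_set_eq]
  congr 1
  refine Nat.card_congr
    (Equiv.ofBijective (fun G => ⟨G, ((G⁻¹ : (Matrix (Fin t) (Fin t) R)ˣ) : Matrix _ _ R), by simp⟩)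
      ⟨fun G G' h => ?_, fun B => ?_⟩)
  · exact Units.ext (Subtype.ext_iff.1 h)
  · obtain ⟨B, L, hL⟩ := B
    exact ⟨⟨B, L, mul_eq_one_comm.1 hL, hL⟩, rfl⟩

theorem mul_mem_matrixSpace {k n m : ℕ} {μ : Fin s → ℕ} (B : Matrix (Fin n) (Fin k) R)
    {E : Matrix (Fin k) (Fin m) R} (hE : E ∈ matrixSpace π k μ m) :
    B * E ∈ matrixSpace π n μ m := by
  intro i
  rw [Matrix.mul_apply_eq_vecMul, Matrix.vecMul_eq_sum]
  exact Submodule.sum_mem _ fun j _ => Submodule.smul_mem _ _ (hE j)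

/-- Every matrix of shape `t` has exactly `|GL_t(R)|` full-rank factorizations. -/
theorem ncard_factorizations (hR : IsFiniteChainRing R π q s) {n t : ℕ} {μ : Fin s → ℕ}
    (S : Set (Matrix (Fin n) (Fin (packetLength μ)) R)) :
    ({p | HasLeftInv p.1 ∧ (p.2 ∈ matrixSpace π t μ (packetLength μ) ∧ HasRightInv p.2) ∧
      p.1 * p.2 ∈ S} :
      Set (Matrix (Fin n) (Fin t) R × Matrix (Fin t) (Fin (packetLength μ)) R)).ncard =
    (shapedMatrices π (fun _ : Fin s => t) n μ ∩ S).ncard *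
      Nat.card (Matrix (Fin t) (Fin t) R)ˣ := by
  have hfac : ∀ Z : ↥(shapedMatrices π (fun _ : Fin s => t) n μ ∩ S),
      ∃ (B : Matrix (Fin n) (Fin t) R) (E : Matrix (Fin t) (Fin (packetLength μ)) R),
        Z.1 = B * E ∧ HasLeftInv B ∧ HasRightInv E :=
    fun Z => (hasShape_const_iff hR).1 Z.2.1.2
  choose B E hZ hB hE using hfac
  choose L hL using hB
  choose F hF using hE
  -- Consequently the rows of `E Z` are combinations of rows of `Z` and lie in `R^μ`.
  have hLZ : ∀ Z, L Z * Z.1 = E Z := fun Z => by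
    rw [hZ, ← Matrix.mul_assoc, hL, Matrix.one_mul]
  have hEm : ∀ Z, E Z ∈ matrixSpace π t μ (packetLength μ) := fun Z => by
    rw [← hLZ]
    exact mul_mem_matrixSpace _ Z.2.1.1
  rw [← Nat.card_coe_set_eq, ← Nat.card_coe_set_eq, ← Nat.card_prod]
  symm
  -- With one factorization of each `Z` fixed, the bijection is `(Z, G) ↦ (B G, G⁻¹ E)`.
  refine Nat.card_congr (Equiv.ofBijective (fun x => ⟨(B x.1 * x.2.val,
    x.2.inv * E x.1), ?_, ⟨?_, ?_⟩, ?_⟩) ⟨?_, ?_⟩)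
  · refine ⟨x.2.inv * L x.1, ?_⟩
    dsimp only
    rw [Matrix.mul_assoc, ← Matrix.mul_assoc (L x.1), hL, Matrix.one_mul, Units.inv_val]
  · exact mul_mem_matrixSpace _ (hEm _)
  · refine ⟨F x.1 * x.2.val, ?_⟩
    dsimp only
    rw [Matrix.mul_assoc, ← Matrix.mul_assoc (E x.1), hF, Matrix.one_mul, Units.inv_val]
  · have : B x.1 * x.2.val *
        (x.2.inv * E x.1) = x.1.1 := by
      rw [Matrix.mul_assoc, ← Matrix.mul_assoc x.2.val, Units.val_inv, Matrix.one_mul,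
        ← hZ]
    simp only [this]
    exact x.1.2.2
  · rintro ⟨Z, G⟩ ⟨Z', G'⟩ h
    simp only [Subtype.mk.injEq, Prod.mk.injEq] at h
    obtain ⟨h1, h2⟩ := h
    have hprod : ∀ (Z) (G : (Matrix (Fin t) (Fin t) R)ˣ), B Z * G.val *
        (G.inv * E Z) = Z.1 := fun Z G => by
      rw [Matrix.mul_assoc, ← Matrix.mul_assoc G.val, Units.val_inv, Matrix.one_mul,
        ← hZ]
    have hZZ : Z = Z' := Subtype.ext (by rw [← hprod Z G, h1, h2, hprod])
    subst hZZ
    refine Prod.ext rfl (Units.ext ?_)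
    have := congrArg (L Z * ·) h1
    simpa only [← Matrix.mul_assoc, hL, Matrix.one_mul] using this
  · rintro ⟨⟨B', E'⟩, ⟨L', hL'⟩, ⟨hm', F', hF'⟩, hS⟩
    dsimp only at hL' hm' hF' hS
    let Z : ↥(shapedMatrices π (fun _ : Fin s => t) n μ ∩ S) :=
      ⟨B' * E', ⟨mul_mem_matrixSpace _ hm', (hasShape_mul_iff hR).2 ⟨⟨L', hL'⟩, F', hF'⟩⟩, hS⟩
    have hBE : B' * E' = B Z * E Z := hZ Z
    have h1 : B' * (E' * F Z) = B Z := by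
      rw [← Matrix.mul_assoc, hBE, Matrix.mul_assoc, hF, Matrix.mul_one]
    have h2 : B Z * (E Z * F') = B' := by
      rw [← Matrix.mul_assoc, ← hBE, Matrix.mul_assoc, hF', Matrix.mul_one]
    -- The change of factorization `G = E Z * F'` is invertible, with inverse `E' * F Z`.
    have h3 : (E Z * F') * (E' * F Z) = 1 := by
      have := congrArg (L Z * ·) (show B Z * (E Z * F') * (E' * F Z) = B Z by rw [h2, h1])
      simpa only [← Matrix.mul_assoc, hL, Matrix.one_mul] using this
    refine ⟨(Z, ⟨E Z * F', E' * F Z, h3, mul_eq_one_comm.1 h3⟩), ?_⟩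
    refine Subtype.ext (Prod.ext h2 ?_)
    change E' * F Z * E Z = E'
    have := congrArg (L' * ·) (show B' * (E' * F Z * E Z) = B' * E' by
      rw [← Matrix.mul_assoc, h1, hBE])
    simpa only [← Matrix.mul_assoc, hL', Matrix.one_mul] using this

end Counting

/-! ### Exact failure probability and its bounds. -/

section FailureProbability

theorem fullRankProb_factor_bounds {q t v i : ℕ} (hq : 2 ≤ q) (htv : t ≤ v)
    (hi : i ∈ Finset.range t) : 0 < (q : ℝ) ^ i / (q : ℝ) ^ v ∧ (q : ℝ) ^ i / (q : ℝ) ^ v ≤ 1 / 2 := by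
  have hq' : (2 : ℝ) ≤ q := by exact_mod_cast hq
  have hi' : i + 1 ≤ v := (Finset.mem_range.1 hi).trans_le htv
  refine ⟨by positivity, ?_⟩
  rw [div_le_div_iff₀ (by positivity) two_pos]
  calc (q : ℝ) ^ i * 2 ≤ (q : ℝ) ^ i * q := by gcongr
    _ = (q : ℝ) ^ (i + 1) := (pow_succ _ _).symm
    _ ≤ 1 * (q : ℝ) ^ v := by
        rw [one_mul]
        exact pow_le_pow_right₀ (by linarith) hi'

theorem fullRankProb_le_one {q t v : ℕ} (hq : 2 ≤ q) (htv : t ≤ v) : fullRankProb q t v ≤ 1 :=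
  Finset.prod_le_one (fun i hi => by have := fullRankProb_factor_bounds hq htv hi; linarith)
    fun i hi => by have := fullRankProb_factor_bounds hq htv hi; linarith

theorem fullRankProb_lt_one {q t v : ℕ} (hq : 2 ≤ q) (ht : 0 < t) (htv : t ≤ v) :
    fullRankProb q t v < 1 := by
  obtain ⟨t, rfl⟩ := Nat.exists_eq_succ_of_ne_zero ht.ne'
  have h := fullRankProb_factor_bounds hq htv (i := t) (by simp)
  have h1 := fullRankProb_le_one hq ((Nat.le_succ t).trans htv)
  have h2 : fullRankProb q (t + 1) v = fullRankProb q t v * (1 - (q : ℝ) ^ t / (q : ℝ) ^ v) :=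
    Finset.prod_range_succ _ _
  rw [h2]
  nlinarith

/-- Crude, but it needs no gap between `t` and `v`; the resulting loss of order `t` in the logarithm
is negligible for the capacity. -/
theorem half_pow_le_fullRankProb {q t v : ℕ} (hq : 2 ≤ q) (htv : t ≤ v) :
    (1 / 2 : ℝ) ^ t ≤ fullRankProb q t v := by
  rw [fullRankProb]
  calc (1 / 2 : ℝ) ^ t = ∏ _i ∈ Finset.range t, (1 / 2 : ℝ) := by simp
    _ ≤ _ := Finset.prod_le_prod (fun i _ => by norm_num) fun i hi => by
        have := fullRankProb_factor_bounds hq htv hi; linarith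

theorem fullRankProb_pos {q t v : ℕ} (hq : 2 ≤ q) (htv : t ≤ v) : 0 < fullRankProb q t v :=
  (by positivity : (0 : ℝ) < (1 / 2) ^ t).trans_le (half_pow_le_fullRankProb hq htv)

/-- The product inequality `∏ (1 - xᵢ) ≥ 1 - ∑ xᵢ`; it is sharp enough when `v - t` is large. -/
theorem one_sub_le_fullRankProb {q t v : ℕ} (hq : 2 ≤ q) (htv : t ≤ v) :
    1 - ∑ i ∈ Finset.range t, (q : ℝ) ^ i / (q : ℝ) ^ v ≤ fullRankProb q t v := by
  induction t with
  | zero => simp [fullRankProb]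
  | succ t ih =>
    have h := fullRankProb_factor_bounds hq htv (i := t) (by simp)
    have h1 := fullRankProb_le_one hq ((Nat.le_succ t).trans htv)
    have h2 : fullRankProb q (t + 1) v = fullRankProb q t v * (1 - (q : ℝ) ^ t / (q : ℝ) ^ v) :=
      Finset.prod_range_succ _ _
    have h3 := ih ((Nat.le_succ t).trans htv)
    rw [h2, Finset.sum_range_succ]
    nlinarith

variable {R : Type*} [CommRing R] {π : R} {q s : ℕ}

/-- The full-rank pairs `(B, E)` are counted in two ways: as a product set, and as `|GL_t(R)|` pairs
over each matrix of shape `t`. -/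
theorem ncard_shapedMatrices_const (hR : IsFiniteChainRing R π q s) {n t : ℕ} {μ : Fin s → ℕ}
    (hμ : Monotone μ) (hn : t ≤ n) (ht : ∀ i, t ≤ μ i) :
    ((shapedMatrices π (fun _ : Fin s => t) n μ).ncard : ℝ) *
        ((q : ℝ) ^ (s * t * t) * fullRankProb q t t) =
      ((q : ℝ) ^ (s * n * t) * fullRankProb q t n) *
        ((q : ℝ) ^ (t * ∑ i, μ i) * fullRankProb q t (μ ⟨0, hR.pos⟩)) := by
  have h := ncard_factorizations hR (t := t) (n := n) (μ := μ) Set.univ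
  simp only [Set.mem_univ, and_true, Set.inter_univ] at h
  change ({B | HasLeftInv B} ×ˢ
    {E | E ∈ matrixSpace π t μ (packetLength μ) ∧ HasRightInv E}).ncard = _ at h
  rw [Set.ncard_prod] at h
  rw [← natCard_units_matrix hR, ← ncard_hasLeftInv hR hn, ← ncard_hasRightInv hR hμ le_packetLength ht]
  exact_mod_cast h.symm

/-- In terms of factorizations the success event is a product: `B₁` left invertible and `E₁` right
invertible. The powers of `q` and `|GL_t(R)|` cancel against the count of all noise matrices. -/
theorem amcFailureProb_eq (hR : IsFiniteChainRing R π q s) {Q : Set R}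
    (hQ : IsResidueSystem π Q) {n t v : ℕ} {μ : Fin s → ℕ} (hμ : Monotone μ) (htv : t ≤ v)
    (hn : v ≤ n) (hv : ∀ i, v ≤ μ i) (hm : v ≤ packetLength μ) (w : AmcMessage Q n μ v) :
    amcFailureProb π Q t μ hn hm w =
      1 - fullRankProb q t v ^ 2 / (fullRankProb q t n * fullRankProb q t (μ ⟨0, hR.pos⟩)) := by
  have := hR.finite
  have hq := hR.two_le
  have hq0 : (0 : ℝ) < q := by positivity
  have hN := ncard_shapedMatrices_const hR hμ (htv.trans hn) fun i => htv.trans (hv i)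
  set bad := {Z | amcDecode π Q t μ hn hm (amcEncode π Q n μ v w + Z) = none} with hbad
  have hgood := ncard_factorizations hR (t := t) (n := n) (μ := μ) badᶜ
  have hset : {p : Matrix (Fin n) (Fin t) R × Matrix (Fin t) (Fin (packetLength μ)) R |
        HasLeftInv p.1 ∧ (p.2 ∈ matrixSpace π t μ (packetLength μ) ∧ HasRightInv p.2) ∧
        p.1 * p.2 ∈ badᶜ} =
      {B | HasLeftInv (B.submatrix (headIdx hn) id)} ×ˢ
        {E | E ∈ matrixSpace π t μ (packetLength μ) ∧ HasRightInv (E.submatrix id (headIdx hm))} := by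
    ext ⟨B, E⟩
    simp only [Set.mem_ofPred_eq, Set.mem_prod, Set.mem_compl_iff, hbad,
      amcDecode_eq_none_iff hR hQ, not_not, hasShape_mul_iff hR]
    constructor
    · rintro ⟨-, ⟨h1, -⟩, h2, h3⟩
      exact ⟨h2, h1, h3⟩
    · rintro ⟨⟨L, hL⟩, h1, ⟨F, hF⟩⟩
      refine ⟨?_, ⟨h1, ?_⟩, ⟨L, hL⟩, F, hF⟩
      -- A left inverse of the head block, padded by zero columns, is a left inverse of all of `B`.
      · refine ⟨L * (1 : Matrix (Fin n) (Fin n) R).submatrix (headIdx hn) id, ?_⟩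
        rw [← hL, Matrix.mul_assoc]
        congr 1
        ext i j
        simp [Matrix.mul_apply, Matrix.one_apply]
      · refine ⟨(1 : Matrix (Fin (packetLength μ)) _ R).submatrix id (headIdx hm) * F, ?_⟩
        rw [← hF, ← Matrix.mul_assoc]
        congr 1
        ext i j
        simp [Matrix.mul_apply, Matrix.one_apply]
  rw [hset, Set.ncard_prod] at hgood
  have hgood' : ((shapedMatrices π (fun _ : Fin s => t) n μ ∩ badᶜ).ncard : ℝ) *
        ((q : ℝ) ^ (s * t * t) * fullRankProb q t t) =
      ((q : ℝ) ^ (s * n * t) * fullRankProb q t v) *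
        ((q : ℝ) ^ (t * ∑ i, μ i) * fullRankProb q t v) := by
    rw [← natCard_units_matrix hR, ← ncard_hasLeftInv_head hR htv hn,
      ← ncard_hasRightInv_head hR hμ le_packetLength htv hv hm]
    exact_mod_cast hgood.symm
  have hadd := Set.ncard_inter_add_ncard_sdiff_eq_ncard
    (shapedMatrices π (fun _ : Fin s => t) n μ) bad (Set.toFinite _)
  have hadd' : ((shapedMatrices π (fun _ : Fin s => t) n μ ∩ bad).ncard : ℝ) +
      (shapedMatrices π (fun _ : Fin s => t) n μ ∩ badᶜ).ncard =
      (shapedMatrices π (fun _ : Fin s => t) n μ).ncard := by exact_mod_cast hadd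
  have hpt := fullRankProb_pos hq (le_refl t)
  have hpn := fullRankProb_pos hq (htv.trans hn)
  have hpm := fullRankProb_pos hq (htv.trans (hv ⟨0, hR.pos⟩))
  have hNpos : 0 < ((shapedMatrices π (fun _ : Fin s => t) n μ).ncard : ℝ) := by
    have : 0 < (shapedMatrices π (fun _ : Fin s => t) n μ).ncard := (Set.ncard_pos (Set.toFinite _)).2
      (shapedMatrices_const_nonempty hR (htv.trans hn) fun i => htv.trans (hv i))
    exact_mod_cast this
  rw [amcFailureProb, uniformProb, eq_sub_of_add_eq hadd', sub_div, div_self hNpos.ne']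
  congr 1
  rw [div_eq_div_iff hNpos.ne' (mul_pos hpn hpm).ne']
  have hc : (0 : ℝ) < (q : ℝ) ^ (s * t * t) * fullRankProb q t t := by positivity
  apply mul_right_cancel₀ hc.ne'
  rw [mul_right_comm, hgood', mul_assoc (_ ^ 2), hN]
  ring

/-- With `p = p(t,v)`, the failure probability is below `1 - p² ≤ 2(1 - p)`. Strictness comes from
the denominator in the exact formula, which is less than `1` because `t > 0`. -/
theorem amcFailureProb_lt_sum (hR : IsFiniteChainRing R π q s) {Q : Set R}
    (hQ : IsResidueSystem π Q) {n t v : ℕ} {μ : Fin s → ℕ} (hμ : Monotone μ) (ht : 0 < t)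
    (htv : t ≤ v) (hn : v ≤ n) (hv : ∀ i, v ≤ μ i) (hm : v ≤ packetLength μ)
    (w : AmcMessage Q n μ v) : amcFailureProb π Q t μ hn hm w <
      2 * ∑ i ∈ Finset.range t, (q : ℝ) ^ i / (q : ℝ) ^ v := by
  have hq := hR.two_le
  rw [amcFailureProb_eq hR hQ hμ htv hn hv]
  have hpv := fullRankProb_pos hq htv
  have hpn := fullRankProb_pos hq (htv.trans hn)
  have hpm := fullRankProb_pos hq (htv.trans (hv ⟨0, hR.pos⟩))
  have hpn1 := fullRankProb_lt_one hq ht (htv.trans hn)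
  have hpm1 := fullRankProb_lt_one hq ht (htv.trans (hv ⟨0, hR.pos⟩))
  have hlt : fullRankProb q t v ^ 2 <
      fullRankProb q t v ^ 2 / (fullRankProb q t n * fullRankProb q t (μ ⟨0, hR.pos⟩)) := by
    rw [lt_div_iff₀ (mul_pos hpn hpm)]
    have : fullRankProb q t n * fullRankProb q t (μ ⟨0, hR.pos⟩) < 1 := by nlinarith
    nlinarith [pow_pos hpv 2]
  have := one_sub_le_fullRankProb hq htv
  nlinarith [sq_nonneg (fullRankProb q t v - 1)]

theorem amcFailureProb_of_zero (hR : IsFiniteChainRing R π q s) {Q : Set R}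
    (hQ : IsResidueSystem π Q) {n v : ℕ} {μ : Fin s → ℕ} (hμ : Monotone μ)
    (hn : v ≤ n) (hv : ∀ i, v ≤ μ i) (hm : v ≤ packetLength μ)
    (w : AmcMessage Q n μ v) : amcFailureProb π Q 0 μ hn hm w = 0 := by
  rw [amcFailureProb_eq hR hQ hμ (Nat.zero_le v) hn hv]
  simp [fullRankProb]

theorem amcFailureProb_lt (hR : IsFiniteChainRing R π q s) {Q : Set R}
    (hQ : IsResidueSystem π Q) {n t v : ℕ} {μ : Fin s → ℕ} (hμ : Monotone μ) (ht : 0 < t)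
    (htv : t ≤ v) (hn : v ≤ n) (hv : ∀ i, v ≤ μ i) (hm : v ≤ packetLength μ)
    (w : AmcMessage Q n μ v) : amcFailureProb π Q t μ hn hm w <
      2 * (t : ℝ) / (q : ℝ) ^ (1 + v - t) := by
  have hq1 : (1 : ℝ) ≤ q := by exact_mod_cast hR.two_le.trans' one_le_two
  refine (amcFailureProb_lt_sum hR hQ hμ ht htv hn hv hm w).trans_le ?_
  rw [mul_div_assoc]
  gcongr
  calc ∑ i ∈ Finset.range t, (q : ℝ) ^ i / (q : ℝ) ^ v
      ≤ ∑ _i ∈ Finset.range t, 1 / (q : ℝ) ^ (1 + v - t) := by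
        -- Each term is bounded by the largest one, `i = t - 1`.
        refine Finset.sum_le_sum fun i hi => ?_
        rw [div_le_div_iff₀ (by positivity) (by positivity), one_mul, ← pow_add]
        exact pow_le_pow_right₀ hq1 (by have := Finset.mem_range.1 hi; omega)
    _ = t / (q : ℝ) ^ (1 + v - t) := by simp [div_eq_mul_inv]

/-- A bound for the failure probability depending on `v - t` only. -/
theorem amcFailureProb_le_pow (hR : IsFiniteChainRing R π q s) {Q : Set R}
    (hQ : IsResidueSystem π Q) {n t v : ℕ} {μ : Fin s → ℕ} (hμ : Monotone μ)
    (htv : t ≤ v) (hn : v ≤ n) (hv : ∀ i, v ≤ μ i) (hm : v ≤ packetLength μ)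
    (w : AmcMessage Q n μ v) : amcFailureProb π Q t μ hn hm w ≤ 2 * (1 / 2 : ℝ) ^ (v - t) := by
  have hq2 : (2 : ℝ) ≤ q := by exact_mod_cast hR.two_le
  rcases Nat.eq_zero_or_pos t with rfl | ht
  · rw [amcFailureProb_of_zero hR hQ hμ hn hv]
    positivity
  refine (amcFailureProb_lt_sum hR hQ hμ ht htv hn hv hm w).le.trans ?_
  gcongr
  -- Summing the geometric series removes the factor `t`. This matters asymptotically: `t` may grow
  -- linearly in `m` while `v - t` tends to infinity arbitrarily slowly.
  have hgeom : ∑ i ∈ Finset.range t, (q : ℝ) ^ i ≤ (q : ℝ) ^ t := by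
    have h := mul_geom_sum (q : ℝ) t
    have h0 : 0 ≤ ∑ i ∈ Finset.range t, (q : ℝ) ^ i := Finset.sum_nonneg fun i _ => by positivity
    nlinarith
  calc ∑ i ∈ Finset.range t, (q : ℝ) ^ i / (q : ℝ) ^ v
      = (∑ i ∈ Finset.range t, (q : ℝ) ^ i) / (q : ℝ) ^ v := by rw [Finset.sum_div]
    _ ≤ (q : ℝ) ^ t / (q : ℝ) ^ v := by gcongr
    _ = (1 / (q : ℝ)) ^ (v - t) := by
        rw [one_div, inv_pow, div_eq_iff (by positivity), inv_mul_eq_div,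
          eq_div_iff (by positivity), ← pow_add, Nat.add_sub_cancel' htv]
    _ ≤ (1 / 2 : ℝ) ^ (v - t) := by gcongr

end FailureProbability

/-! ### Capacity of symmetric channels and of the AMC. -/

section Capacity

/-- The capacity of a channel whose transition probabilities take only the values `0` and `1 / N`
and form a doubly stochastic matrix. -/
theorem channelCapacity_eq_logb {α : Type*} [Fintype α] [Nonempty α] {b N : ℝ} (hb : 1 < b)
    (hN : 0 < N) {W : α → α → ℝ} (hW : ∀ x y, W x y = 0 ∨ W x y = 1 / N)
    (hrow : ∀ x, ∑ y, W x y = 1) (hcol : ∀ y, ∑ x, W x y = 1) :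
    channelCapacity b W = Real.logb b (Fintype.card α / N) := by
  have hc : (0 : ℝ) < Fintype.card α := by exact_mod_cast Fintype.card_pos
  have hlb : 0 < Real.log b := Real.log_pos hb
  have hW0 : ∀ x y, 0 ≤ W x y := fun x y => by
    rcases hW x y with h | h <;> rw [h]
    positivity
  refine IsGreatest.csSup_eq ⟨⟨fun _ => 1 / Fintype.card α, ⟨fun _ => by positivity, ?_⟩, ?_⟩, ?_⟩
  · simp [hc.ne']
  · simp only [mutualInformation, ← Finset.mul_sum, hcol, mul_one]
    have hterm : ∀ x y, 1 / (Fintype.card α : ℝ) * W x y *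
        Real.logb b (W x y / (1 / Fintype.card α)) =
        1 / (Fintype.card α : ℝ) * Real.logb b (Fintype.card α / N) * W x y := by
      intro x y
      rcases hW x y with h | h <;> rw [h]
      · simp
      · rw [show 1 / N / (1 / (Fintype.card α : ℝ)) = Fintype.card α / N by field_simp]
        ring
    simp only [hterm, ← Finset.mul_sum, hrow, Finset.sum_const, Finset.card_univ, nsmul_eq_mul]
    field_simp
  · rintro _ ⟨p, ⟨hp0, hp1⟩, rfl⟩
    set r : α → ℝ := fun y => ∑ x, p x * W x y with hr
    -- Where `p x * W x y > 0`, the quotient `W / r` equals `(|α| / N) * (1 / (|α| r))`, and `log z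
    -- ≤ z - 1` is applied to the second factor. The corrections sum to at most `0`: this is Gibbs'
    -- inequality against the uniform output distribution.
    have hterm : ∀ x y, p x * W x y * Real.logb b (W x y / r y) ≤
        Real.logb b (Fintype.card α / N) * (p x * W x y) +
          (p x * W x y * (1 / (Fintype.card α * r y)) - p x * W x y) / Real.log b := by
      intro x y
      rcases (mul_nonneg (hp0 x) (hW0 x y)).eq_or_lt with h0 | h0
      · simp [← h0]
      have hry : 0 < r y := h0.trans_le (Finset.single_le_sum (f := fun x => p x * W x y)
        (fun x _ => mul_nonneg (hp0 x) (hW0 x y)) (Finset.mem_univ x))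
      have hWN : W x y = 1 / N := (hW x y).resolve_left fun h => by simp [h] at h0
      have hlog : Real.logb b (W x y / r y) ≤ Real.logb b (Fintype.card α / N) +
          (1 / (Fintype.card α * r y) - 1) / Real.log b := by
        have he : W x y / r y = Fintype.card α / N * (1 / (Fintype.card α * r y)) := by
          rw [hWN]
          field_simp
        rw [he, Real.logb_mul (by positivity) (by positivity)]
        gcongr
        rw [Real.logb]
        gcongr
        exact Real.log_le_sub_one_of_pos (by positivity)
      calc _ ≤ p x * W x y * (Real.logb b (Fintype.card α / N) +
          (1 / (Fintype.card α * r y) - 1) / Real.log b) := by gcongr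
        _ = _ := by ring
    have htot : ∑ x, ∑ y, p x * W x y = 1 := by
      simp only [← Finset.mul_sum, hrow, mul_one]
      exact hp1
    have hsum : ∑ x, ∑ y, p x * W x y * (1 / (Fintype.card α * r y)) ≤ 1 := by
      rw [Finset.sum_comm]
      have : ∀ y, ∑ x, p x * W x y * (1 / (Fintype.card α * r y)) ≤ 1 / Fintype.card α := by
        intro y
        rw [← Finset.sum_mul]
        change r y * _ ≤ _
        -- An output of probability zero contributes `0`, so only an inequality holds in general.
        by_cases h : r y = 0
        · rw [h, zero_mul]
          positivity
        · refine le_of_eq ?_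
          field_simp
      refine (Finset.sum_le_sum fun y _ => this y).trans_eq ?_
      simp [hc.ne']
    dsimp only [mutualInformation]
    refine (Finset.sum_le_sum fun x _ => Finset.sum_le_sum fun y _ => hterm x y).trans ?_
    simp only [Finset.sum_add_distrib, ← Finset.mul_sum, ← Finset.sum_div, Finset.sum_sub_distrib]
    simp only [← Finset.mul_sum] at htot ⊢
    rw [htot]
    have : (∑ x, ∑ y, p x * W x y * (1 / (Fintype.card α * r y)) - 1) / Real.log b ≤ 0 :=
      div_nonpos_of_nonpos_of_nonneg (by linarith) hlb.le
    linarith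

variable {R : Type*} [CommRing R] {π : R} {q s : ℕ}

theorem add_mem_matrixSpace {n m : ℕ} {μ : Fin s → ℕ} {X Y : Matrix (Fin n) (Fin m) R}
    (hX : X ∈ matrixSpace π n μ m) (hY : Y ∈ matrixSpace π n μ m) : X + Y ∈ matrixSpace π n μ m :=
  fun i => Submodule.add_mem _ (hX i) (hY i)

theorem sub_mem_matrixSpace {n m : ℕ} {μ : Fin s → ℕ} {X Y : Matrix (Fin n) (Fin m) R}
    (hX : X ∈ matrixSpace π n μ m) (hY : Y ∈ matrixSpace π n μ m) : X - Y ∈ matrixSpace π n μ m :=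
  fun i => Submodule.sub_mem _ (hX i) (hY i)

open Classical in
theorem amcTransition_eq {τ : Fin s → ℕ} {n : ℕ} {μ : Fin s → ℕ}
    (X Y : matrixSpace π n μ (packetLength μ)) :
    amcTransition π τ n μ X Y = if Y.1 - X.1 ∈ shapedMatrices π τ n μ then
      1 / ((shapedMatrices π τ n μ).ncard : ℝ) else 0 := by
  have hset : {Z | X.1 + Z = Y.1} = {Y.1 - X.1} := by
    ext Z
    exact ⟨fun h => eq_sub_of_add_eq' h, fun h => by
      rw [Set.mem_singleton_iff.1 h]; exact add_sub_cancel _ _⟩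
  rw [amcTransition, uniformProb, hset]
  split_ifs with h
  · rw [Set.inter_eq_right.2 (Set.singleton_subset_iff.2 h)]
    simp
  · rw [Set.inter_singleton_eq_empty.2 h]
    simp

/-- The AMC is symmetric, so its capacity is attained by the uniform input distribution. -/
theorem amcCapacity_eq [Finite R] {b : ℕ} (hb : 2 ≤ b) {τ : Fin s → ℕ} {n : ℕ} {μ : Fin s → ℕ}
    (hne : (shapedMatrices π τ n μ).Nonempty) :
    amcCapacity π b τ n μ = Real.logb b ((matrixSpace π n μ (packetLength μ)).ncard /
      (shapedMatrices π τ n μ).ncard) := by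
  classical
  let _ : Fintype (matrixSpace π n μ (packetLength μ)) := Fintype.ofFinite _
  have hNpos : 0 < ((shapedMatrices π τ n μ).ncard : ℝ) := by
    exact_mod_cast (Set.ncard_pos (Set.toFinite _)).2 hne
  have hnonempty : Nonempty (matrixSpace π n μ (packetLength μ)) := ⟨⟨_, hne.some_mem.1⟩⟩
  -- Rows and columns of the transition matrix are both supported on translates (up to sign) of the
  -- set of noise matrices, so they have the same number of nonzero entries.
  have hsum : ∀ (p : matrixSpace π n μ (packetLength μ) → Prop) [DecidablePred p],
      Nat.card {Y // p Y} = (shapedMatrices π τ n μ).ncard →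
      ∑ Y, (if p Y then 1 / ((shapedMatrices π τ n μ).ncard : ℝ) else 0) = 1 := by
    intro p _ h
    rw [← Finset.sum_filter, Finset.sum_const, ← Fintype.card_subtype, ← Nat.card_eq_fintype_card,
      h, nsmul_eq_mul, mul_one_div_cancel hNpos.ne']
  rw [Set.ncard_eq_toFinset_card', Set.toFinset_card]
  refine channelCapacity_eq_logb (by exact_mod_cast hb) hNpos (fun X Y => ?_) (fun X => ?_)
    fun Y => ?_
  · rw [amcTransition_eq]
    split_ifs <;> simp
  · simp only [amcTransition_eq]
    refine hsum _ ?_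
    rw [← Nat.card_coe_set_eq]
    exact Nat.card_congr
      { toFun := fun Y => ⟨Y.1.1 - X.1, Y.2⟩
        invFun := fun Z => ⟨⟨X.1 + Z.1, add_mem_matrixSpace X.2 Z.2.1⟩, by simp⟩
        left_inv := fun Y => by simp
        right_inv := fun Z => by simp }
  · simp only [amcTransition_eq]
    refine hsum _ ?_
    rw [← Nat.card_coe_set_eq]
    exact Nat.card_congr
      { toFun := fun X => ⟨Y.1 - X.1.1, X.2⟩
        invFun := fun Z => ⟨⟨Y.1 - Z.1, sub_mem_matrixSpace Y.2 Z.2.1⟩, by simp⟩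
        left_inv := fun X => by simp
        right_inv := fun Z => by simp }

theorem logb_fullRankProb_bounds {q t v : ℕ} (hq : 2 ≤ q) (htv : t ≤ v) :
    -(t : ℝ) ≤ Real.logb q (fullRankProb q t v) ∧ Real.logb q (fullRankProb q t v) ≤ 0 := by
  have hq2 : (2 : ℝ) ≤ q := by exact_mod_cast hq
  have hq1 : (1 : ℝ) < q := by linarith
  refine ⟨?_, Real.logb_nonpos hq1 (fullRankProb_pos hq htv).le (fullRankProb_le_one hq htv)⟩
  rw [Real.le_logb_iff_rpow_le hq1 (fullRankProb_pos hq htv), Real.rpow_neg (by positivity),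
    Real.rpow_natCast, ← inv_pow]
  refine le_trans ?_ (half_pow_le_fullRankProb hq htv)
  rw [one_div]
  gcongr

/-- The capacity of the AMC, up to an error of order `t`. -/
theorem abs_amcCapacity_sub_le [Finite R] (hR : IsFiniteChainRing R π q s) {n t : ℕ}
    {μ : Fin s → ℕ} (hμ : Monotone μ) (hn : t ≤ n) (ht : ∀ i, t ≤ μ i) :
    |amcCapacity π q (fun _ : Fin s => t) n μ - ∑ i, ((n : ℝ) - t) * ((μ i : ℝ) - t)| ≤ 2 * t := by
  have hq := hR.two_le
  have hq1 : (1 : ℝ) < q := by exact_mod_cast hq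
  have hq0 : (0 : ℝ) < q := by linarith
  have hne := shapedMatrices_const_nonempty hR hn ht
  have hN := ncard_shapedMatrices_const hR hμ hn ht
  have hNpos : 0 < ((shapedMatrices π (fun _ : Fin s => t) n μ).ncard : ℝ) := by
    exact_mod_cast (Set.ncard_pos (Set.toFinite _)).2 hne
  have hpt := fullRankProb_pos hq (le_refl t)
  have hpn := fullRankProb_pos hq hn
  have hpm := fullRankProb_pos hq (ht ⟨0, hR.pos⟩)
  have bt := logb_fullRankProb_bounds hq (le_refl t)
  have bn := logb_fullRankProb_bounds hq hn
  have bm := logb_fullRankProb_bounds hq (ht ⟨0, hR.pos⟩)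
  have hlq : ∀ k : ℕ, Real.logb q ((q : ℝ) ^ k) = k := fun k => by
    rw [Real.logb_pow, Real.logb_self_eq_one hq1, mul_one]
  have hlog := congrArg (Real.logb q) hN
  rw [Real.logb_mul hNpos.ne' (by positivity), Real.logb_mul (by positivity) hpt.ne',
    Real.logb_mul (by positivity) (by positivity), Real.logb_mul (by positivity) hpn.ne',
    Real.logb_mul (by positivity) hpm.ne', hlq, hlq, hlq] at hlog
  have hC : amcCapacity π q (fun _ : Fin s => t) n μ = (n * ∑ i, μ i : ℕ) -
      Real.logb q (shapedMatrices π (fun _ : Fin s => t) n μ).ncard := by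
    rw [amcCapacity_eq hq hne, ncard_matrixSpace hR n hμ le_packetLength, Nat.cast_pow,
      Real.logb_div (by positivity) hNpos.ne', hlq]
  have hsum : ∑ i, ((n : ℝ) - t) * ((μ i : ℝ) - t) =
      n * ∑ i, (μ i : ℝ) - s * n * t - t * ∑ i, (μ i : ℝ) + s * t * t := by
    rw [← Finset.mul_sum, Finset.sum_sub_distrib]
    simp only [Finset.sum_const, Finset.card_univ, Fintype.card_fin, nsmul_eq_mul]
    ring
  push_cast at hlog hC
  rw [abs_le, hC, hsum]
  -- The difference is `log p(t,t) - log p(t,n) - log p(t,μ₁)`, and each logarithm lies in `[-t,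
  -- 0]`.
  constructor <;> linarith

end Capacity

/-! ### Limits for growing packet length. -/

section Asymptotics

/-- In the asymptotic regime, a quantity within `O(m)` of `∑ (n - v) (μᵢ - v)` has the expected
limit after normalization, provided that `v / m` tends to `τ`. -/
theorem tendsto_normalized {s : ℕ} {nbar τbar : ℝ} {μbar : Fin s → ℝ} {n v m : ℕ → ℕ}
    {μ : ℕ → Fin s → ℕ} {C : ℕ → ℝ} {K : ℝ} (hm : Tendsto m atTop atTop)
    (hn : ∀ k, (n k : ℝ) = nbar * m k) (hμ : ∀ k i, (μ k i : ℝ) = μbar i * m k)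
    (hv : Tendsto (fun k => (v k : ℝ) / m k) atTop (𝓝 τbar))
    (hC : ∀ k, |C k - ∑ i, ((n k : ℝ) - v k) * ((μ k i : ℝ) - v k)| ≤ K * m k) :
    Tendsto (fun k => C k / ((n k : ℝ) * ∑ i, (μ k i : ℝ))) atTop
      (𝓝 ((∑ i, (nbar - τbar) * (μbar i - τbar)) / (nbar * ∑ i, μbar i))) := by
  have hm' : Tendsto (fun k => (m k : ℝ)) atTop atTop := tendsto_natCast_atTop_atTop.comp hm
  have hpos : ∀ᶠ k in atTop, (0 : ℝ) < m k := hm'.eventually_gt_atTop 0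
  have herr : Tendsto (fun k => (C k - ∑ i, ((n k : ℝ) - v k) * ((μ k i : ℝ) - v k)) / (m k : ℝ) ^ 2)
      atTop (𝓝 0) := by
    have hK : Tendsto (fun k => K / (m k : ℝ)) atTop (𝓝 0) := hm'.const_div_atTop K
    refine squeeze_zero_norm' (hpos.mono fun k hk => ?_) hK
    rw [norm_div, Real.norm_eq_abs, Real.norm_of_nonneg (by positivity), div_le_div_iff₀
      (by positivity) hk]
    nlinarith [hC k]
  have hmain : Tendsto (fun k => ∑ i, (nbar - (v k : ℝ) / m k) * (μbar i - (v k : ℝ) / m k)) atTop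
      (𝓝 (∑ i, (nbar - τbar) * (μbar i - τbar))) :=
    tendsto_finsetSum _ fun i _ => (tendsto_const_nhds.sub hv).mul (tendsto_const_nhds.sub hv)
  have h := (hmain.add herr).div_const (nbar * ∑ i, μbar i)
  rw [add_zero] at h
  refine h.congr' (hpos.mono fun k hk => ?_)
  have hk' := hk.ne'
  have h1 : ∑ i, (nbar - (v k : ℝ) / m k) * (μbar i - (v k : ℝ) / m k) =
      (∑ i, ((n k : ℝ) - v k) * ((μ k i : ℝ) - v k)) / (m k : ℝ) ^ 2 := by
    rw [Finset.sum_div]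
    refine Finset.sum_congr rfl fun i _ => ?_
    rw [hn, hμ]
    field_simp
  have h2 : (n k : ℝ) * ∑ i, (μ k i : ℝ) = (m k : ℝ) ^ 2 * (nbar * ∑ i, μbar i) := by
    simp only [hn, hμ, ← Finset.sum_mul]
    ring
  dsimp only
  rw [h1, h2, ← add_div, div_div]
  congr 1
  ring

/-- A choice of the number of zero rows and columns for which the failure probability vanishes
and the rate is asymptotically optimal. -/
theorem exists_trap_size {s : ℕ} (hs : 0 < s) {nbar τbar : ℝ} {μbar : Fin s → ℝ} {n t m : ℕ → ℕ}
    {μ : ℕ → Fin s → ℕ} (hmono : ∀ k, Monotone (μ k)) (hm : Tendsto m atTop atTop)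
    (hn : ∀ k, (n k : ℝ) = nbar * m k) (hμ : ∀ k i, (μ k i : ℝ) = μbar i * m k)
    (ht : ∀ k, (t k : ℝ) = τbar * m k) (htn : ∀ k, t k ≤ n k) (htμ : ∀ k i, t k ≤ μ k i)
    (hlt : τbar < nbar) (hlt' : ∀ i, τbar < μbar i) :
    ∃ v : ℕ → ℕ, (∀ k, t k ≤ v k) ∧ (∀ k, v k ≤ n k) ∧ (∀ k i, v k ≤ μ k i) ∧
      Tendsto (fun k => (v k : ℝ) - t k) atTop atTop ∧
      Tendsto (fun k => ((v k : ℝ) - t k) / m k) atTop (𝓝 0) := by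
  have hm' : Tendsto (fun k => (m k : ℝ)) atTop atTop := tendsto_natCast_atTop_atTop.comp hm
  -- `d` is the excess `v - t`. The square root forces `d / m → 0`; the other two terms ensure `v ≤
  -- n` and `v ≤ μ₁` for every `k`, and tend to infinity by the strict inequalities on the ratios.
  set d : ℕ → ℕ := fun k => min (Nat.sqrt (m k)) (min (n k - t k) (μ k ⟨0, hs⟩ - t k)) with hd
  have hdiff : ∀ k, ((t k + d k : ℕ) : ℝ) - t k = d k := fun k => by push_cast; ring
  have hsqrt : Tendsto (fun k => Nat.sqrt (m k)) atTop atTop := by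
    rw [tendsto_atTop]
    intro b
    filter_upwards [hm.eventually_ge_atTop (b * b)] with k hk
    exact Nat.le_sqrt.2 hk
  have hsub : ∀ {f : ℕ → ℕ} {c : ℝ}, (∀ k, (f k : ℝ) = c * m k) → (∀ k, t k ≤ f k) → τbar < c →
      Tendsto (fun k => f k - t k) atTop atTop := by
    intro f c hf htf hc
    rw [← tendsto_natCast_atTop_iff (R := ℝ)]
    refine (hm'.const_mul_atTop (sub_pos.2 hc)).congr fun k => ?_
    rw [Nat.cast_sub (htf k), hf, ht]
    ring
  have hdt : Tendsto d atTop atTop := by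
    rw [tendsto_atTop]
    intro b
    filter_upwards [hsqrt.eventually_ge_atTop b, (hsub hn htn hlt).eventually_ge_atTop b,
      (hsub (fun k => hμ k ⟨0, hs⟩) (fun k => htμ k _) (hlt' _)).eventually_ge_atTop b]
      with k h1 h2 h3
    exact le_min h1 (le_min h2 h3)
  refine ⟨fun k => t k + d k, fun k => Nat.le_add_right _ _, fun k => ?_, fun k i => ?_, ?_, ?_⟩
  · have : d k ≤ n k - t k := (min_le_right _ _).trans (min_le_left _ _)
    have := htn k
    change t k + d k ≤ _
    omega
  · have : d k ≤ μ k ⟨0, hs⟩ - t k := (min_le_right _ _).trans (min_le_right _ _)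
    have := htμ k ⟨0, hs⟩
    have := hmono k (show (⟨0, hs⟩ : Fin s) ≤ i from Nat.zero_le _)
    change t k + d k ≤ _
    omega
  · simp only [hdiff]
    exact tendsto_natCast_atTop_atTop.comp hdt
  · simp only [hdiff]
    have hlim : Tendsto (fun k => 1 / (Nat.sqrt (m k) : ℝ)) atTop (𝓝 0) :=
      (tendsto_natCast_atTop_atTop.comp hsqrt).const_div_atTop 1
    refine squeeze_zero' (Eventually.of_forall fun k => by positivity) ?_ hlim
    filter_upwards [hsqrt.eventually_gt_atTop 0, hm.eventually_gt_atTop 0] with k h1 h2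
    rw [div_le_div_iff₀ (by exact_mod_cast h2) (by exact_mod_cast h1), one_mul]
    have h3 : d k * Nat.sqrt (m k) ≤ m k :=
      (Nat.mul_le_mul_right _ (min_le_left _ _)).trans (Nat.sqrt_le _)
    exact_mod_cast h3

end Asymptotics

theorem mainTheorem10 {R : Type*} [CommRing R] [Finite R] {π : R} {q s : ℕ}
    (hR : IsFiniteChainRing R π q s) {Q : Set R} (hQ : IsResidueSystem π Q) :
    -- the scheme for fixed parameters
    (∀ (n t v : ℕ) (μ : Fin s → ℕ), Monotone μ → t ≤ v →
      ∀ (hvn : v ≤ n) (hvμ : ∀ i, v ≤ μ i),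
        (Set.range (amcEncode π Q n μ v) =
            padMatrix v '' matrixSpace π (n - v) (fun i => μ i - v) (packetLength μ - v)) ∧
        (∀ w, amcEncode π Q n μ v w ∈ matrixSpace π n μ (packetLength μ)) ∧
        Function.Injective (amcEncode π Q n μ v) ∧
        amcRate π q Q n μ v = ∑ i, ((n : ℝ) - v) * ((μ i : ℝ) - v) ∧
        (shapedMatrices π (fun _ : Fin s => t) n μ).Nonempty ∧
        (∀ (w : AmcMessage Q n μ v) (B : Matrix (Fin n) (Fin t) R)
            (E : Matrix (Fin t) (Fin (packetLength μ)) R),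
          B * E ∈ shapedMatrices π (fun _ : Fin s => t) n μ →
            (amcDecode π Q t μ hvn (hR.le_packetLength hvμ) (amcEncode π Q n μ v w + B * E) = none ↔
              ¬ HasShape π (fun _ : Fin s => t)
                (B.submatrix (headIdx hvn) id *
                  E.submatrix id (headIdx (hR.le_packetLength hvμ))))) ∧
        ∀ w : AmcMessage Q n μ v,
          amcErrorProb π Q t μ hvn (hR.le_packetLength hvμ) w = 0 ∧
          (0 < t → amcFailureProb π Q t μ hvn (hR.le_packetLength hvμ) w
              < 2 * (t : ℝ) / (q : ℝ) ^ (1 + v - t)) ∧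
          (t = 0 → amcFailureProb π Q t μ hvn (hR.le_packetLength hvμ) w = 0)) ∧
    -- the asymptotic regime: the packet length tends to infinity, with fixed ratios
    (∀ (nbar τbar : ℝ) (μbar : Fin s → ℝ) (n t : ℕ → ℕ) (μ : ℕ → Fin s → ℕ),
      0 < nbar →
      (∀ k, Monotone (μ k)) →
      Tendsto (fun k => packetLength (μ k)) atTop atTop →
      (∀ k, (n k : ℝ) = nbar * packetLength (μ k)) →
      (∀ k i, (μ k i : ℝ) = μbar i * packetLength (μ k)) →
      (∀ k, (t k : ℝ) = τbar * packetLength (μ k)) →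
      (∀ k, t k ≤ n k) → (∀ k i, t k ≤ μ k i) →
        Tendsto (fun k => amcCapacity π q (fun _ : Fin s => t k) (n k) (μ k)
            / ((n k : ℝ) * ∑ i, (μ k i : ℝ))) atTop
          (𝓝 ((∑ i, (nbar - τbar) * (μbar i - τbar)) / (nbar * ∑ i, μbar i))) ∧
        (∀ (v : ℕ → ℕ), (∀ k, t k ≤ v k) →
          ∀ (hvn : ∀ k, v k ≤ n k) (hvμ : ∀ k i, v k ≤ μ k i),
            Tendsto (fun k => (v k : ℝ) - t k) atTop atTop →
            Tendsto (fun k => ((v k : ℝ) - t k) / packetLength (μ k)) atTop (𝓝 0) →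
              (∀ k w, amcErrorProb π Q (t k) (μ k) (hvn k) (hR.le_packetLength (hvμ k)) w = 0) ∧
              (∀ ε : ℝ, 0 < ε → ∀ᶠ k in atTop, ∀ w,
                amcFailureProb π Q (t k) (μ k) (hvn k) (hR.le_packetLength (hvμ k)) w < ε) ∧
              Tendsto (fun k => amcRate π q Q (n k) (μ k) (v k)
                  / ((n k : ℝ) * ∑ i, (μ k i : ℝ))) atTop
                (𝓝 ((∑ i, (nbar - τbar) * (μbar i - τbar)) / (nbar * ∑ i, μbar i)))) ∧
        (τbar < nbar → (∀ i, τbar < μbar i) →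
          ∃ v : ℕ → ℕ, (∀ k, t k ≤ v k) ∧ (∀ k, v k ≤ n k) ∧ (∀ k i, v k ≤ μ k i) ∧
            Tendsto (fun k => (v k : ℝ) - t k) atTop atTop ∧
            Tendsto (fun k => ((v k : ℝ) - t k) / packetLength (μ k)) atTop (𝓝 0))) := by
  refine ⟨fun n t v μ hμ htv hvn hvμ => ⟨range_amcEncode hR hQ n hμ v, amcEncode_mem hR hQ n hμ v,
    amcEncode_injective hR hQ n μ v, amcRate_eq hR hQ hvn hvμ,
    shapedMatrices_const_nonempty hR (htv.trans hvn) fun i => htv.trans (hvμ i),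
    fun w B E _ => amcDecode_eq_none_iff hR hQ hvn _ w B E,
    fun w => ⟨amcErrorProb_eq_zero hR hQ hvn _ w,
      fun ht => amcFailureProb_lt hR hQ hμ ht htv hvn hvμ _ w, ?_⟩⟩, ?_⟩
  · rintro rfl
    exact amcFailureProb_of_zero hR hQ hμ hvn hvμ _ w
  intro nbar τbar μbar n t μ _ hmono hm hn hμ ht htn htμ
  have hm' : Tendsto (fun k => (packetLength (μ k) : ℝ)) atTop atTop :=
    tendsto_natCast_atTop_atTop.comp hm
  have hτ : Tendsto (fun k => (t k : ℝ) / packetLength (μ k)) atTop (𝓝 τbar) :=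
    tendsto_const_nhds.congr' ((hm'.eventually_ne_atTop 0).mono fun k hk => by
      dsimp only
      rw [ht, mul_div_cancel_right₀ _ hk])
  -- The capacity error `2t` equals `2 * τbar * m`.
  refine ⟨tendsto_normalized (K := 2 * τbar) hm hn hμ hτ fun k => ?_,
    fun v htv hvn hvμ hv hv0 => ⟨fun k w => amcErrorProb_eq_zero hR hQ (hvn k) _ w,
      fun ε hε => ?_, ?_⟩, fun hlt hlt' =>
        exists_trap_size hR.pos hmono hm hn hμ ht htn htμ hlt hlt'⟩
  · refine (abs_amcCapacity_sub_le hR (hmono k) (htn k) (htμ k)).trans_eq ?_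
    rw [ht]
    ring
  · have hvt : Tendsto (fun k => v k - t k) atTop atTop := by
      rw [← tendsto_natCast_atTop_iff (R := ℝ)]
      exact hv.congr fun k => (Nat.cast_sub (htv k)).symm
    have hlim : Tendsto (fun k => 2 * (1 / 2 : ℝ) ^ (v k - t k)) atTop (𝓝 0) := by
      have := ((tendsto_pow_atTop_nhds_zero_of_lt_one (r := (1 / 2 : ℝ)) (by norm_num)
        (by norm_num)).comp hvt).const_mul 2
      simpa using this
    filter_upwards [hlim.eventually_lt_const hε] with k hk w
    exact (amcFailureProb_le_pow hR hQ (hmono k) (htv k) (hvn k) (hvμ k) _ w).trans_lt hk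
  -- The rate formula is exact, so `K = 0`; and `v / m` has the same limit as `t / m`.
  · refine tendsto_normalized (v := v) (K := 0) hm hn hμ ?_ fun k => ?_
    · have := hv0.add hτ
      rw [zero_add] at this
      exact this.congr fun k => by ring
    · rw [amcRate_eq hR hQ (hvn k) (hvμ k), sub_self, abs_zero, zero_mul]
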